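/- Let $\mathbb N=\{1,2,\dots\}$ and let $c_{00}$ be the space of finitely supported real sequences on $\mathbb N$, whose elements also act as functionals by $f(x)=\sum_i f(i)x(i)$. For nonzero $f,g\in c_{00}$ write $f<g$ if $\max\operatorname{supp} f<\min\operatorname{supp} g$; a block sequence is a sequence $x_1<x_2<\cdots$ of nonzero elements of $c_{00}$. Let $m_1=2^8$, $m_{j+1}=m_j^5$, $n_1=2^7$, $n_{j+1}=(2n_j)^{s_{j+1}}$ with $s_{j+1}=\log_2(m_{j+1}^4)$. Let $G_0$ be the smallest subset of $c_{00}$ that contains all $e_n^*$, satisfies $-G_0=G_0$, contains $\frac1{m_{2j}}\sum_{i=1}^d f_i$ whenever $j\ge1$, $1\le d\le n_{2j}$ and $f_1<\dots<f_d$ in $G_0$ (an element that can be written in this form is said to have weight $m_{2j}$), and contains $\sum_{i=1}^d a_if_i$ whenever $a_i\in\mathbb Q$, $\sum a_i^2\le1$ and the $f_i\in G_0$ have pairwise different weights. Let $\Omega_1,\Omega_2\subset\mathbb N$ be disjoint and infinite, let $Q_s$ be the set of all finite sequences $(f_1,\dots,f_d)$, $d\ge1$, of nonzero elements of $G_0$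 with $f_1<\dots<f_d$, and let $\sigma:Q_s\to\{2j:j\in\Omega_2\}$ be injective with $$m_{\sigma(f_1,\dots,f_d)}>\max\Big\{\tfrac1{|f_i(e_l)|}:1\le i\le d,\ l\in\operatorname{supp} f_i\Big\}\cdot\max\operatorname{supp} f_d .$$ For $j\ge 1$, a sequence $(f_i)_{i=1}^{n_{2j+1}}\in Q_s$ is called $\sigma$-$n_{2j+1}$ special if every $f_i$ has a weight, $f_1$ has weight $m_{2j_1}$ for some $j_1\in\Omega_1$ with $n_{2j+1}^2<m_{2j_1}$, and $f_{i+1}$ has weight $m_{\sigma(f_1,\dots,f_i)}$ for $1\le i<n_{2j+1}$. Let $W_0$ be the smallest subset of $c_{00}$ that contains $G_0$ and all $\frac1{m_{2j+1}}\sum_{i=1}^{n_{2j+1}}f_i$ with $j\ge 1$ and $(f_i)$ a $\sigma$-$n_{2j+1}$ special sequence, satisfies $-W_0=W_0$, and is closed under restrictions to finite intervals of $\mathbb N$. For $S\in\{G_0,W_0\}$ let $\|x\|_{S}=\sup\{|f(x)|:f\in S\}$. **Proposition.** Let $\varepsilon>0$ and let $(x_n)_{n\in\mathbb N}$ be a block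 sequence with $\varepsilon<\|x_n\|_{G_0}\le\|x_n\|_{W_0}\le1$ for all $n$. Then for every $n\in\mathbb N$ there are $k>n$ and $y_1<\dots<y_k$ in the linear span of $\{x_i:i\in\mathbb N\}$ such that $\|y_i\|_{W_0}\le1$ for $i=1,\dots,k$ and $y=\frac1k(y_1+\dots+y_k)$ satisfies $\frac12<\|y\|_{G_0}=\|y\|_{W_0}$. -/

import Mathlib

namespace X0

/-- The recursive sequence `m_1 = 2^8`, `m_{j+1} = m_j^5` (the value at `0` is never used). -/
def m : ℕ → ℕ
  | 0 => 1
  | 1 => 2 ^ 8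
  | j + 2 => m (j + 1) ^ 5

/-- The recursive sequence `n_1 = 2^7`, `n_{j+1} = (2 n_j)^{s_{j+1}}` with
`s_{j+1} = log_2 (m_{j+1}^4)` (the value at `0` is never used). Every `m_j` with `j ≥ 1` is a
power of `2`, so the logarithm is a natural number and `Nat.log` computes it exactly. -/
def n : ℕ → ℕ
  | 0 => 1
  | 1 => 2 ^ 7
  | j + 2 => (2 * n (j + 1)) ^ Nat.log 2 (m (j + 2) ^ 4)

/-- The space `c₀₀` of finitely supported real sequences indexed by `1, 2, 3, …`. -/
abbrev C00 : Type := ℕ+ →₀ ℝ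

/-- The action `f(x) = ∑ f(i) x(i)` of `f ∈ c₀₀` as a functional on `c₀₀`. -/
noncomputable def pairing (f x : C00) : ℝ := f.sum fun i a => a * x i

/-- `f < g` for finitely supported sequences: both are nonzero and
`max supp f < min supp g`. -/
def Before (f g : C00) : Prop :=
  f ≠ 0 ∧ g ≠ 0 ∧ ∀ a ∈ f.support, ∀ b ∈ g.support, a < b

/-- A finite sequence `f_1 < ⋯ < f_d`, `d ≥ 1`, of nonzero elements. -/
def Successive (L : List C00) : Prop :=
  L ≠ [] ∧ (∀ f ∈ L, f ≠ 0) ∧ L.Pairwise Before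

/-- A block sequence: `x_0 < x_1 < x_2 < ⋯`. -/
def IsBlockSeq (x : ℕ → C00) : Prop := ∀ i, Before (x i) (x (i + 1))

/-- `f` has weight `w` with respect to `S`: `w = m_{2j}` and `f = (1/m_{2j}) ∑_{i ≤ d} f_i` for
some `j ≥ 1`, `1 ≤ d ≤ n_{2j}` and `f_1 < ⋯ < f_d` in `S`. This is a relation: one `f` may have
several weights. -/
def HasWeight (S : Set C00) (w : ℕ) (f : C00) : Prop :=
  ∃ j : ℕ, 1 ≤ j ∧ w = m (2 * j) ∧ ∃ L : List C00, Successive L ∧ L.length ≤ n (2 * j) ∧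
    (∀ g ∈ L, g ∈ S) ∧ f = (1 / (m (2 * j) : ℝ)) • L.sum

/-- The closure properties that define `G₀`. -/
structure GClosed (S : Set C00) : Prop where
  basis : ∀ i : ℕ+, Finsupp.single i (1 : ℝ) ∈ S
  neg : ∀ f ∈ S, -f ∈ S
  /-- closure under the `(𝒜_{n_{2j}}, 1/m_{2j})`-operations, `j ≥ 1` -/
  op : ∀ j : ℕ, 1 ≤ j → ∀ L : List C00, Successive L → L.length ≤ n (2 * j) →
    (∀ g ∈ L, g ∈ S) → (1 / (m (2 * j) : ℝ)) • L.sum ∈ S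
  /-- closure under rational `ℓ²`-convex combinations of elements with pairwise different
  weights -/
  comb : ∀ d : ℕ, 1 ≤ d → ∀ (a : Fin d → ℚ) (f : Fin d → C00) (w : Fin d → ℕ),
    ∑ i, a i ^ 2 ≤ 1 → (∀ i, f i ∈ S) → (∀ i, HasWeight S (w i) (f i)) →
    Function.Injective w → ∑ i, (a i : ℝ) • f i ∈ S

/-- The norming set `G₀`: the minimal set with the properties `GClosed`. -/
def G₀ : Set C00 := ⋂₀ {S | GClosed S}

theorem HasWeight.mono {S T : Set C00} (h : S ⊆ T) {w : ℕ} {f : C00} (hf : HasWeight S w f) :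
    HasWeight T w f := by
  obtain ⟨j, hj, hw, L, hL, hl, hS, rfl⟩ := hf
  exact ⟨j, hj, hw, L, hL, hl, fun g hg => h (hS g hg), rfl⟩

/-- The minimal set exists: `G₀` itself has the properties `GClosed`. -/
theorem isLeast_G₀ : IsLeast {S : Set C00 | GClosed S} G₀ := by
  refine ⟨⟨?_, ?_, ?_, ?_⟩, fun S hS => Set.sInter_subset_of_mem hS⟩
  · exact fun i S hS => hS.basis i
  · exact fun f hf S hS => hS.neg f (hf S hS)
  · exact fun j hj L hL hl hG S hS => hS.op j hj L hL hl fun g hg => hG g hg S hS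
  · exact fun d hd a f w ha hf hw hinj S hS => hS.comb d hd a f w ha (fun i => hf i S hS)
      (fun i => (hw i).mono (Set.sInter_subset_of_mem hS)) hinj

/-- The set `Q_s` of finite sequences `f_1 < ⋯ < f_d`, `d ≥ 1`, of nonzero elements of `G₀`. -/
def Qs : Set (List C00) := {L | Successive L ∧ ∀ f ∈ L, f ∈ G₀}

/-- `Ω₁, Ω₂` are disjoint infinite sets of positive integers and `σ` restricts to an injective map
`Q_s → {2j : j ∈ Ω₂}` such that
`m_{σ(f_1, …, f_d)} > max {1 / |f_i(e_l)| : i ≤ d, l ∈ supp f_i} · max supp f_d`.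
Only the values of `σ` on `Q_s` matter. -/
structure IsCoding (Ω₁ Ω₂ : Set ℕ) (σ : List C00 → ℕ) : Prop where
  pos₁ : ∀ j ∈ Ω₁, 1 ≤ j
  pos₂ : ∀ j ∈ Ω₂, 1 ≤ j
  infinite₁ : Ω₁.Infinite
  infinite₂ : Ω₂.Infinite
  disjoint : Disjoint Ω₁ Ω₂
  mapsTo : ∀ L ∈ Qs, ∃ j ∈ Ω₂, σ L = 2 * j
  injOn : Set.InjOn σ Qs
  growth : ∀ L, ∀ hL : L ∈ Qs, ∀ f ∈ L, ∀ l ∈ f.support, ∀ r ∈ (L.getLast hL.1.1).support,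
    1 / |f l| * ((r : ℕ) : ℝ) < (m (σ L) : ℝ)

/-- `L = (f_1, …, f_{n_{2j+1}})` is a `σ`-`n_{2j+1}` special sequence. In the last clause
`L.take i = (f_1, …, f_i)`, and `L[i]` (counted from `0`) is `f_{i+1}`. -/
structure IsSpecial (Ω₁ : Set ℕ) (σ : List C00 → ℕ) (j : ℕ) (L : List C00) : Prop where
  mem : L ∈ Qs
  length_eq : L.length = n (2 * j + 1)
  weight : ∀ f ∈ L, ∃ w, HasWeight G₀ w f
  first : ∃ j₁ ∈ Ω₁, n (2 * j + 1) ^ 2 < m (2 * j₁) ∧ HasWeight G₀ (m (2 * j₁)) (L.head mem.1.1)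
  next : ∀ i, 1 ≤ i → ∀ hi : i < L.length, HasWeight G₀ (m (σ (L.take i))) L[i]

/-- The properties that define `W₀`. -/
structure WClosed (Ω₁ : Set ℕ) (σ : List C00 → ℕ) (S : Set C00) : Prop where
  base : G₀ ⊆ S
  special : ∀ j : ℕ, 1 ≤ j → ∀ L, IsSpecial Ω₁ σ j L → (1 / (m (2 * j + 1) : ℝ)) • L.sum ∈ S
  neg : ∀ f ∈ S, -f ∈ S
  /-- closure under restrictions to finite intervals of the index set -/
  restrict : ∀ f ∈ S, ∀ a b : ℕ+, f.filter (fun i => a ≤ i ∧ i ≤ b) ∈ S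

/-- The norming set `W₀`: the minimal set with the properties `WClosed`. -/
def W₀ (Ω₁ : Set ℕ) (σ : List C00 → ℕ) : Set C00 := ⋂₀ {S | WClosed Ω₁ σ S}

/-- The minimal set exists: `W₀` itself has the properties `WClosed`. -/
theorem isLeast_W₀ (Ω₁ : Set ℕ) (σ : List C00 → ℕ) :
    IsLeast {S : Set C00 | WClosed Ω₁ σ S} (W₀ Ω₁ σ) := by
  refine ⟨⟨?_, ?_, ?_, ?_⟩, fun S hS => Set.sInter_subset_of_mem hS⟩
  · exact fun f hf S hS => hS.base hf
  · exact fun j hj L hL S hS => hS.special j hj L hL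
  · exact fun f hf S hS => hS.neg f (hf S hS)
  · exact fun f hf a b S hS => hS.restrict f (hf S hS) a b

/-- The norm `‖x‖_S = sup {|f(x)| : f ∈ S}` induced by a norming set `S`. -/
noncomputable def normOf (S : Set C00) (x : C00) : ℝ := sSup {t | ∃ f ∈ S, t = |pairing f x|}

end X0

namespace X0

/-! ### The duality pairing -/

/-! The proof is James' blocking argument, run on a subsequence on which special functionals are
nearly invisible. Fix a large `q`, put `k = n_{2q-1} ^ 2`, and form iterated averages of `k`
consecutive terms, doubled at each level. A single `(n_{2q}, 1/m_{2q})`-operation shows that level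
`T`, where `2 ^ T = m_{2q} ^ 2`, has `G₀`-norm at least `m_{2q} ε > 1` (`le_normOf_G₀_iterAvg`).
Hence some level lies in the `W₀`-unit ball while a vector of the next level does not
(`exists_level`). Half of that vector is the average `y`, and its `W₀`-norm exceeds `1/2`.

It remains to see that functionals of `W₀` outside `G₀` are at most `1/2` on `y`; then `G₀` alone
determines the norm (`normOf_G₀_eq_normOf_W₀`). If `j < q`, a special functional has at most
`n_{2q-1}` terms, so it is large on few of the `k` blocks (`abs_special_average_le`). If `j ≥ q`,
the subsequence is chosen so that it is large on at most two of the original vectors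
(`exists_subseq_card_le_two`).

That choice rests on a counting bound (`card_hitBoth_le`): for fixed `j` and `x_{p'}`, only
boundedly many earlier `x_p` can be hit together with `x_{p'}`. Special sequences that differ before
`x_{p'}` use different weights from there on, by injectivity of `σ`; too many of them would combine,
through the `ℓ²`-closure of `G₀`, into an element of value above `1` on `x_{p'}`. Those that agree
there form one short sequence, which hits few vectors. Bounded back-degree gives a finite colouring,
hence infinite independent sets, and a diagonal argument handles all `j`. -/

theorem pairing_eq_sum {f x : C00} {s : Finset ℕ+} (hs : f.support ⊆ s) :
    pairing f x = ∑ i ∈ s, f i * x i :=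
  Finsupp.sum_of_support_subset f hs _ (by simp)

theorem pairing_comm (f x : C00) : pairing f x = pairing x f := by
  classical
  rw [pairing_eq_sum (Finset.subset_union_left : f.support ⊆ f.support ∪ x.support),
    pairing_eq_sum (Finset.subset_union_right : x.support ⊆ f.support ∪ x.support)]
  exact Finset.sum_congr rfl fun i _ => mul_comm _ _

theorem pairing_add_left (f g x : C00) : pairing (f + g) x = pairing f x + pairing g x :=
  Finsupp.sum_add_index' (by simp) (by intros; ring)

theorem pairing_smul_left (c : ℝ) (f x : C00) : pairing (c • f) x = c * pairing f x := by
  rw [pairing_eq_sum (Finsupp.support_smul : (c • f).support ⊆ f.support),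
    pairing_eq_sum (Finset.Subset.refl f.support), Finset.mul_sum]
  exact Finset.sum_congr rfl fun i _ => by simp [mul_assoc]

/-- The pairing as a bilinear form. -/
noncomputable def pairingBilin : C00 →ₗ[ℝ] C00 →ₗ[ℝ] ℝ :=
  LinearMap.mk₂ ℝ pairing pairing_add_left (fun c f x => pairing_smul_left c f x)
    (fun f x y => by rw [pairing_comm, pairing_add_left, pairing_comm x, pairing_comm y])
    (fun c f x => by rw [pairing_comm, pairing_smul_left, pairing_comm x]; rfl)

theorem pairing_zero_left (x : C00) : pairing 0 x = 0 := by
  simp [pairing]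

theorem pairing_neg_left (f x : C00) : pairing (-f) x = -pairing f x := by
  exact pairingBilin.map_neg₂ f x

theorem pairing_smul_right (c : ℝ) (f x : C00) : pairing f (c • x) = c * pairing f x := by
  rw [pairing_comm, pairing_smul_left, pairing_comm x]

theorem pairing_sum_left {ι : Type*} (s : Finset ι) (f : ι → C00) (x : C00) :
    pairing (∑ i ∈ s, f i) x = ∑ i ∈ s, pairing (f i) x := by
  exact pairingBilin.map_sum₂ s f x

theorem pairing_sum_right {ι : Type*} (s : Finset ι) (f : C00) (x : ι → C00) :
    pairing f (∑ i ∈ s, x i) = ∑ i ∈ s, pairing f (x i) := by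
  rw [pairing_comm, pairing_sum_left]
  exact Finset.sum_congr rfl fun i _ => pairing_comm _ _

theorem pairing_list_sum_left (L : List C00) (x : C00) :
    pairing L.sum x = (L.map fun f => pairing f x).sum := by
  induction L with
  | nil => simp [pairing_zero_left]
  | cons f L ih => simp [pairing_add_left, ih]

theorem support_filter_subset (P : ℕ+ → Prop) [DecidablePred P] (f : C00) :
    (f.filter P).support ⊆ f.support := by
  rw [Finsupp.support_filter]
  exact Finset.filter_subset _ _

theorem pairing_filter (P : ℕ+ → Prop) [DecidablePred P] (f x : C00) :
    pairing (f.filter P) x = pairing f (x.filter P) := by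
  rw [pairing_eq_sum (support_filter_subset P f),
    pairing_eq_sum (Finset.Subset.refl f.support)]
  refine Finset.sum_congr rfl fun i _ => ?_
  by_cases h : P i <;> simp [h]

theorem pairing_eq_zero {f x : C00} (h : ∀ a ∈ f.support, a ∉ x.support) : pairing f x = 0 := by
  rw [pairing_eq_sum (Finset.Subset.refl f.support)]
  exact Finset.sum_eq_zero fun i hi => by rw [Finsupp.notMem_support_iff.1 (h i hi), mul_zero]

theorem abs_pairing_le {f x : C00} {c : ℝ} (h : ∀ i, |f i| ≤ c) :
    |pairing f x| ≤ c * ∑ i ∈ x.support, |x i| := by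
  rw [pairing_comm, pairing_eq_sum (Finset.Subset.refl x.support), Finset.mul_sum]
  refine (Finset.abs_sum_le_sum_abs _ _).trans (Finset.sum_le_sum fun i _ => ?_)
  rw [abs_mul, mul_comm]
  exact mul_le_mul_of_nonneg_right (h i) (abs_nonneg _)

/-! ### The sequences `m` and `n` -/

theorem m_succ_eq (j : ℕ) : m (j + 1) = 2 ^ (8 * 5 ^ j) := by
  induction j with
  | zero => rfl
  | succ j ih => rw [m, ih, ← pow_mul]; congr 1; ring

theorem m_strictMono : StrictMono m := by
  refine strictMono_nat_of_lt_succ fun j => ?_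
  rcases j with _ | j
  · simp [m]
  · rw [m_succ_eq, m_succ_eq]
    have : 0 < 5 ^ j := by positivity
    exact Nat.pow_lt_pow_right (by norm_num) (by rw [pow_succ]; omega)

theorem m_pos (j : ℕ) : 0 < m j := by
  have := m_strictMono.monotone (Nat.zero_le j)
  exact lt_of_lt_of_le (by simp [m]) this

theorem two_pow_succ_le_m_two_mul {j : ℕ} (hj : 1 ≤ j) : 2 ^ (j + 1) ≤ m (2 * j) := by
  obtain ⟨i, rfl⟩ : ∃ i, j = i + 1 := ⟨j - 1, by omega⟩
  rw [show 2 * (i + 1) = (2 * i + 1) + 1 by ring, m_succ_eq]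
  refine Nat.pow_le_pow_right (by norm_num) ?_
  have : 2 * i + 1 < 5 ^ (2 * i + 1) := Nat.lt_pow_self (by norm_num)
  omega

theorem log_two_m_pow_four (j : ℕ) : Nat.log 2 (m (j + 1) ^ 4) = 4 * (8 * 5 ^ j) := by
  rw [m_succ_eq, ← pow_mul, Nat.log_pow (by norm_num), mul_comm]

theorem n_strictMono : StrictMono n := by
  have hpos : ∀ j, 0 < n j := by
    intro j
    induction j using Nat.twoStepInduction with
    | zero => simp [n]
    | one => simp [n]
    | more j _ ih => rw [n]; positivity
  refine strictMono_nat_of_lt_succ fun j => ?_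
  rcases j with _ | j
  · simp [n]
  · rw [n, log_two_m_pow_four]
    have h1 : 2 * n (j + 1) ≤ (2 * n (j + 1)) ^ (4 * (8 * 5 ^ (j + 1))) :=
      Nat.le_self_pow (by positivity) _
    have := hpos (j + 1)
    omega

theorem n_pos (j : ℕ) : 0 < n j := by
  have := n_strictMono.monotone (Nat.zero_le j)
  exact lt_of_lt_of_le (by simp [n]) this

/-! ### Successive sequences -/

theorem Before.trans {f g h : C00} (h₁ : Before f g) (h₂ : Before g h) : Before f h := by
  refine ⟨h₁.1, h₂.2.1, fun a ha b hb => ?_⟩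
  obtain ⟨c, hc⟩ := Finsupp.support_nonempty_iff.2 h₁.2.1
  exact (h₁.2.2 a ha c hc).trans (h₂.2.2 c hc b hb)

theorem IsBlockSeq.before {x : ℕ → C00} (hx : IsBlockSeq x) {i j : ℕ} (hij : i < j) :
    Before (x i) (x j) := by
  induction j, hij using Nat.le_induction with
  | base => exact hx i
  | succ j _ ih => exact ih.trans (hx j)

/-- At each coordinate at most one term of a successive list is nonzero. -/
theorem abs_list_sum_apply_le {L : List C00} (hL : L.Pairwise Before) {c : ℝ} (hc : 0 ≤ c)
    (h : ∀ f ∈ L, ∀ i, |f i| ≤ c) (i : ℕ+) : |L.sum i| ≤ c := by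
  induction L with
  | nil => simpa using hc
  | cons f L ih =>
    rw [List.pairwise_cons] at hL
    rw [List.sum_cons, Finsupp.add_apply]
    by_cases hf : f i = 0
    · rw [hf, zero_add]
      exact ih hL.2 fun g hg => h g (List.mem_cons_of_mem _ hg)
    · have h0 : L.sum i = 0 := by
        have h' : ∀ g ∈ L, g i = 0 := fun g hg => by
          by_contra hgi
          exact lt_irrefl i ((hL.1 g hg).2.2 i (Finsupp.mem_support_iff.2 hf) i
            (Finsupp.mem_support_iff.2 hgi))
        clear ih hL h
        induction L with
        | nil => simp
        | cons g L ih =>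
          rw [List.sum_cons, Finsupp.add_apply, h' g (by simp),
            ih fun g hg => h' g (List.mem_cons_of_mem _ hg), add_zero]
      rw [h0, add_zero]
      exact h f (by simp) i

section Filter
variable (P : ℕ+ → Prop) [DecidablePred P]

open Classical in
/-- The nonzero restrictions of the terms of a list. -/
noncomputable def restrictList (L : List C00) : List C00 :=
  (L.map (Finsupp.filter P)).filter (· ≠ 0)

theorem sum_restrictList (L : List C00) : (restrictList P L).sum = L.sum.filter P := by
  classical
  induction L with
  | nil => simp [restrictList, Finsupp.filter_zero]
  | cons f L ih =>
    rw [List.sum_cons, Finsupp.filter_add, ← ih]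
    by_cases h : f.filter P = 0
    · simp [restrictList, h]
    · simp [restrictList, h]

theorem length_restrictList_le (L : List C00) : (restrictList P L).length ≤ L.length := by
  simpa [restrictList] using (List.length_filter_le (· ≠ 0) (L.map (Finsupp.filter P)))

theorem exists_of_mem_restrictList {L : List C00} {g : C00} (hg : g ∈ restrictList P L) :
    g ≠ 0 ∧ ∃ f ∈ L, f.filter P = g := by
  classical
  simp only [restrictList, List.mem_filter, List.mem_map, decide_eq_true_eq] at hg
  exact ⟨hg.2, hg.1⟩

theorem successive_restrictList {L : List C00} (hL : Successive L) (h : restrictList P L ≠ []) :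
    Successive (restrictList P L) := by
  classical
  refine ⟨h, fun g hg => (exists_of_mem_restrictList P hg).1, ?_⟩
  have hp : (L.map (Finsupp.filter P)).Pairwise fun f g => f ≠ 0 → g ≠ 0 → Before f g := by
    rw [List.pairwise_map]
    refine hL.2.2.imp fun {f g} hfg hf hg => ⟨hf, hg, fun a ha b hb => ?_⟩
    exact hfg.2.2 a (support_filter_subset P f ha) b (support_filter_subset P g hb)
  rw [restrictList, List.pairwise_filter]
  refine hp.imp fun {f g} hfg hf hg => hfg (by simpa using hf) (by simpa using hg)

theorem HasWeight.filter {S T : Set C00} {w : ℕ} {f : C00} (hST : ∀ g ∈ S, g.filter P ∈ T)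
    (hf : HasWeight S w f) : f.filter P ≠ 0 → HasWeight T w (f.filter P) := by
  obtain ⟨j, hj, hw, L, hL, hl, hS, rfl⟩ := hf
  rw [Finsupp.filter_smul, ← sum_restrictList]
  intro h0
  refine ⟨j, hj, hw, _, successive_restrictList P hL ?_, (length_restrictList_le P L).trans hl,
    fun g hg => ?_, rfl⟩
  · rintro h; simp [h] at h0
  · obtain ⟨-, f, hf, rfl⟩ := exists_of_mem_restrictList P hg
    exact hST f (hS f hf)

end Filter

/-! ### The norming set `G₀` -/

theorem gClosed_G₀ : GClosed G₀ := isLeast_G₀.1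

theorem HasWeight.mem {w : ℕ} {f : C00} (h : HasWeight G₀ w f) : f ∈ G₀ := by
  obtain ⟨j, hj, -, L, hL, hl, hG, rfl⟩ := h
  exact gClosed_G₀.op j hj L hL hl hG

theorem zero_mem_G₀ : (0 : C00) ∈ G₀ := by
  have h : HasWeight G₀ (m (2 * 1)) ((1 / (m (2 * 1) : ℝ)) • [Finsupp.single 1 1].sum) := by
    refine ⟨1, le_rfl, rfl, [Finsupp.single 1 1], ⟨by simp, by simp, by simp⟩, ?_, ?_, rfl⟩
    · exact n_pos _
    · simpa using gClosed_G₀.basis 1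
  have := gClosed_G₀.comb 1 le_rfl (fun _ => 0) (fun _ => _) (fun _ => _) (by simp)
    (fun _ => h.mem) (fun _ => h) (Function.injective_of_subsingleton _)
  simpa using this

/-- Closure of `G₀` under rational `ℓ²`-convex combinations indexed by a finite set, where
vanishing terms need not have a weight. -/
theorem sum_mem_G₀ {ι : Type*} (s : Finset ι) (a : ι → ℚ) (f : ι → C00) (w : ι → ℕ)
    (ha : ∑ i ∈ s, a i ^ 2 ≤ 1) (hf : ∀ i ∈ s, f i ≠ 0 → HasWeight G₀ (w i) (f i))
    (hw : Set.InjOn w {i | i ∈ s ∧ f i ≠ 0}) : ∑ i ∈ s, (a i : ℝ) • f i ∈ G₀ := by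
  classical
  set t := s.filter fun i => f i ≠ 0 with ht
  have hsum : ∑ i ∈ s, (a i : ℝ) • f i = ∑ i ∈ t, (a i : ℝ) • f i := by
    rw [ht, Finset.sum_filter_of_ne]
    rintro i - hi h0
    simp [h0] at hi
  rw [hsum]
  rcases t.eq_empty_or_nonempty with h | h
  · rw [h, Finset.sum_empty]; exact zero_mem_G₀
  have hmem : ∀ i : Fin t.card, (t.equivFin.symm i : ι) ∈ s ∧ f (t.equivFin.symm i) ≠ 0 := fun i =>
    Finset.mem_filter.1 (t.equivFin.symm i).2
  have hconv : ∀ {M : Type} [AddCommMonoid M] (g : ι → M),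
      ∑ i ∈ t, g i = ∑ i : Fin t.card, g (t.equivFin.symm i) := by
    intro M _ g
    rw [← Finset.sum_coe_sort t g]
    exact (Equiv.sum_comp t.equivFin.symm fun i : t => g i).symm
  rw [hconv]
  refine gClosed_G₀.comb t.card h.card_pos (fun i => a (t.equivFin.symm i))
    (fun i => f (t.equivFin.symm i)) (fun i => w (t.equivFin.symm i)) ?_
    (fun i => (hf _ (hmem i).1 (hmem i).2).mem) (fun i => hf _ (hmem i).1 (hmem i).2) ?_
  · rw [← hconv fun i => a i ^ 2]
    exact (Finset.sum_le_sum_of_subset_of_nonneg (Finset.filter_subset _ _)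
      fun i _ _ => sq_nonneg _).trans ha
  · intro i i' hii
    exact t.equivFin.symm.injective (Subtype.ext (hw (hmem i) (hmem i') hii))

/-- By minimality of `G₀`: restriction only shortens the list in an operation and so preserves
weights, except for terms that vanish, which `sum_mem_G₀` tolerates. Arbitrary sets are allowed
because norming functionals are later cut down to the supports of the vectors. -/
theorem filter_mem_G₀ (P : ℕ+ → Prop) [DecidablePred P] {f : C00} (hf : f ∈ G₀) :
    f.filter P ∈ G₀ := by
  classical
  suffices h : GClosed {f : C00 | f.filter P ∈ G₀} from isLeast_G₀.2 h hf
  refine ⟨fun i => ?_, fun f hf => ?_, fun j hj L hL hl hG => ?_,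
    fun d hd a f w ha hf hw hinj => ?_⟩
  · by_cases h : P i
    · rw [Set.mem_ofPred_eq, Finsupp.filter_single_of_pos _ h]; exact gClosed_G₀.basis i
    · rw [Set.mem_ofPred_eq, Finsupp.filter_single_of_neg _ h]; exact zero_mem_G₀
  · rw [Set.mem_ofPred_eq, Finsupp.filter_neg]; exact gClosed_G₀.neg _ hf
  · by_cases h0 : ((1 / (m (2 * j) : ℝ)) • L.sum).filter P = 0
    · rw [Set.mem_ofPred_eq, h0]; exact zero_mem_G₀
    · exact (HasWeight.filter P (fun g hg => hg) ⟨j, hj, rfl, L, hL, hl, hG, rfl⟩ h0).mem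
  · have : (∑ i, (a i : ℝ) • f i).filter P = ∑ i, (a i : ℝ) • (f i).filter P := by
      change Finsupp.filterAddHom P _ = _
      rw [map_sum]
      exact Finset.sum_congr rfl fun i _ => Finsupp.filter_smul
    rw [Set.mem_ofPred_eq, this]
    exact sum_mem_G₀ _ a _ w ha (fun i _ => (hw i).filter P fun g hg => hg) hinj.injOn

/-- An element of weight `w` has coordinates at most `1 / w`. In an `ℓ²`-combination the weights
differ and `m (2 * j) ≥ 2 ^ (j + 1)`, so these bounds sum to at most `1`. -/
theorem abs_apply_le_one_of_mem_G₀ {f : C00} (hf : f ∈ G₀) (i : ℕ+) : |f i| ≤ 1 := by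
  suffices h : GClosed {f : C00 | ∀ i, |f i| ≤ 1} from isLeast_G₀.2 h hf i
  have hop : ∀ {w f}, HasWeight {f : C00 | ∀ i, |f i| ≤ 1} w f → ∀ i, |f i| ≤ 1 / (w : ℝ) := by
    rintro w f ⟨j, -, rfl, L, hL, -, hS, rfl⟩ i
    have hm : (0 : ℝ) < m (2 * j) := by exact_mod_cast m_pos _
    rw [Finsupp.smul_apply, smul_eq_mul, abs_mul, abs_of_pos (by positivity)]
    exact mul_le_of_le_one_right (by positivity) (abs_list_sum_apply_le hL.2.2 zero_le_one hS i)
  refine ⟨fun i k => ?_, fun f hf i => ?_, fun j hj L hL hl hG i => ?_,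
    fun d hd a f w ha hf hw hinj i => ?_⟩
  · rw [Finsupp.single_apply]; split_ifs <;> simp
  · rw [Finsupp.neg_apply, abs_neg]; exact hf i
  · refine (hop ⟨j, hj, rfl, L, hL, hl, hG, rfl⟩ i).trans ?_
    exact div_le_one_of_le₀ (by exact_mod_cast m_pos _) (Nat.cast_nonneg _)
  · have ha1 : ∀ l, |(a l : ℝ)| ≤ 1 := fun l => by
      rw [← sq_le_one_iff_abs_le_one]
      exact_mod_cast (Finset.single_le_sum (f := fun i => a i ^ 2) (fun i _ => sq_nonneg _)
        (Finset.mem_univ l)).trans ha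
    choose j hj hwj _ using fun l => hw l
    have hjinj : Function.Injective j := fun l l' h => hinj (by rw [hwj, hwj, h])
    rw [Finsupp.finsetSum_apply]
    calc |∑ l, ((a l : ℝ) • f l) i| ≤ ∑ l, |((a l : ℝ) • f l) i| :=
          Finset.abs_sum_le_sum_abs _ _
      _ ≤ ∑ l, (1 / 2 : ℝ) * (1 / 2) ^ j l := by
          refine Finset.sum_le_sum fun l _ => ?_
          rw [Finsupp.smul_apply, smul_eq_mul, abs_mul]
          refine (mul_le_of_le_one_left (abs_nonneg _) (ha1 l)).trans ((hop (hw l) i).trans ?_)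
          have h2 : (2 : ℝ) ^ (j l + 1) ≤ w l := by
            rw [hwj]; exact_mod_cast two_pow_succ_le_m_two_mul (hj l)
          calc 1 / (w l : ℝ) ≤ 1 / 2 ^ (j l + 1) := one_div_le_one_div_of_le (by positivity) h2
            _ = _ := by rw [pow_succ, one_div_pow]; field_simp
      _ = (1 / 2 : ℝ) * ∑ l ∈ Finset.univ.image j, (1 / 2 : ℝ) ^ l := by
          rw [Finset.sum_image hjinj.injOn, Finset.mul_sum]
      _ ≤ (1 / 2 : ℝ) * 2 := by
          refine mul_le_mul_of_nonneg_left ?_ (by norm_num)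
          exact (summable_geometric_two.sum_le_tsum _ fun _ _ => by positivity).trans
            tsum_geometric_two.le
      _ = 1 := by norm_num

/-! ### The norming set `W₀` -/

theorem IsSpecial.abs_filter_apply_le {Ω₁ : Set ℕ} {σ : List C00 → ℕ} {j : ℕ} {L : List C00}
    (hL : IsSpecial Ω₁ σ j L) (P : ℕ+ → Prop) [DecidablePred P] (i : ℕ+) :
    |L.sum.filter P i| ≤ 1 := by
  rw [Finsupp.filter_apply]
  split_ifs
  · exact abs_list_sum_apply_le hL.mem.1.2.2 zero_le_one
      (fun f hf => abs_apply_le_one_of_mem_G₀ (hL.mem.2 f hf)) i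
  · simp

open Classical in
-- Replacing intervals by arbitrary sets `P` makes the described family visibly closed under further
-- restriction, so minimality of `W₀` applies.
theorem mem_W₀_cases {Ω₁ : Set ℕ} {σ : List C00 → ℕ} {f : C00} (hf : f ∈ W₀ Ω₁ σ) :
    f ∈ G₀ ∨ ∃ j, 1 ≤ j ∧ ∃ L, IsSpecial Ω₁ σ j L ∧ ∃ (P : ℕ+ → Prop) (s : ℝ),
      |s| = 1 ∧ f = s • (1 / (m (2 * j + 1) : ℝ)) • L.sum.filter P := by
  let S : Set C00 := {f | f ∈ G₀ ∨ ∃ j, 1 ≤ j ∧ ∃ L, IsSpecial Ω₁ σ j L ∧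
    ∃ (P : ℕ+ → Prop) (s : ℝ),
      |s| = 1 ∧ f = s • (1 / (m (2 * j + 1) : ℝ)) • L.sum.filter P}
  suffices h : WClosed Ω₁ σ S from (isLeast_W₀ Ω₁ σ).2 h hf
  refine ⟨fun f hf => Or.inl hf, fun j hj L hL => Or.inr ?_, ?_, ?_⟩
  · refine ⟨j, hj, L, hL, fun _ => True, 1, by simp, ?_⟩
    ext i; simp
  · rintro f (hf | ⟨j, hj, L, hL, P, s, hs, rfl⟩)
    · exact Or.inl (gClosed_G₀.neg f hf)
    · exact Or.inr ⟨j, hj, L, hL, P, -s, by rwa [abs_neg], by rw [neg_smul]⟩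
  · rintro f (hf | ⟨j, hj, L, hL, P, s, hs, rfl⟩) a b
    · exact Or.inl (filter_mem_G₀ _ hf)
    · refine Or.inr ⟨j, hj, L, hL, fun i => P i ∧ (a ≤ i ∧ i ≤ b), s, hs, ?_⟩
      ext i
      by_cases h1 : P i <;> by_cases h2 : a ≤ i ∧ i ≤ b <;> simp [h1, h2]

theorem G₀_subset_W₀ (Ω₁ : Set ℕ) (σ : List C00 → ℕ) : G₀ ⊆ W₀ Ω₁ σ := (isLeast_W₀ Ω₁ σ).1.base

theorem abs_apply_le_one_of_mem_W₀ {Ω₁ : Set ℕ} {σ : List C00 → ℕ} {f : C00}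
    (hf : f ∈ W₀ Ω₁ σ) (i : ℕ+) : |f i| ≤ 1 := by
  classical
  rcases mem_W₀_cases hf with h | ⟨j, -, L, hL, P, s, hs, rfl⟩
  · exact abs_apply_le_one_of_mem_G₀ h i
  · rw [Finsupp.smul_apply, Finsupp.smul_apply, smul_eq_mul, smul_eq_mul, abs_mul, abs_mul, hs,
      one_mul]
    refine mul_le_one₀ ?_ (abs_nonneg _) (hL.abs_filter_apply_le P i)
    rw [abs_of_nonneg (by positivity)]
    exact div_le_one_of_le₀ (by exact_mod_cast m_pos _) (Nat.cast_nonneg _)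

/-! ### The norms -/

/-- Needed because the real `sSup` of an unbounded set is the default value `0`. -/
theorem bddAbove_abs_pairing {S : Set C00} (hS : ∀ f ∈ S, ∀ i, |f i| ≤ 1) (x : C00) :
    BddAbove {t | ∃ f ∈ S, t = |pairing f x|} := by
  refine ⟨1 * ∑ i ∈ x.support, |x i|, ?_⟩
  rintro t ⟨f, hf, rfl⟩
  exact abs_pairing_le (hS f hf)

theorem abs_pairing_le_normOf_G₀ {f : C00} (hf : f ∈ G₀) (x : C00) :
    |pairing f x| ≤ normOf G₀ x :=
  le_csSup (bddAbove_abs_pairing (fun _ h => abs_apply_le_one_of_mem_G₀ h) x) ⟨f, hf, rfl⟩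

theorem abs_pairing_le_normOf_W₀ {Ω₁ : Set ℕ} {σ : List C00 → ℕ} {f : C00} (hf : f ∈ W₀ Ω₁ σ)
    (x : C00) : |pairing f x| ≤ normOf (W₀ Ω₁ σ) x :=
  le_csSup (bddAbove_abs_pairing (fun _ h => abs_apply_le_one_of_mem_W₀ h) x) ⟨f, hf, rfl⟩

theorem normOf_le {S : Set C00} (h0 : (0 : C00) ∈ S) {x : C00} {c : ℝ}
    (h : ∀ f ∈ S, |pairing f x| ≤ c) : normOf S x ≤ c := by
  refine csSup_le ⟨_, 0, h0, rfl⟩ ?_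
  rintro t ⟨f, hf, rfl⟩
  exact h f hf

theorem exists_lt_pairing_of_lt_normOf_G₀ {x : C00} {c : ℝ} (hc : c < normOf G₀ x) :
    ∃ f ∈ G₀, c < pairing f x := by
  have hne : {t | ∃ f ∈ G₀, t = |pairing f x|}.Nonempty := ⟨_, 0, zero_mem_G₀, rfl⟩
  obtain ⟨t, ⟨f, hf, rfl⟩, ht⟩ := exists_lt_of_lt_csSup hne hc
  rcases abs_cases (pairing f x) with h | h
  · exact ⟨f, hf, h.1 ▸ ht⟩
  · exact ⟨-f, gClosed_G₀.neg f hf, by rw [pairing_neg_left, ← h.1]; exact ht⟩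


/-! ### Action of a successive sequence of functionals on a block sequence -/

/-- Some element of the support of `f` lies to the left of the whole support of `x`. -/
def StartsBefore (f x : C00) : Prop := ∃ a ∈ f.support, ∀ b ∈ x.support, a < b

theorem StartsBefore.of_before {f g x : C00} (hfg : Before f g) (hg : StartsBefore g x) :
    StartsBefore f x := by
  obtain ⟨a, ha⟩ := Finsupp.support_nonempty_iff.2 hfg.1
  obtain ⟨b, hb, hbx⟩ := hg
  exact ⟨a, ha, fun c hc => (hfg.2.2 a ha b hb).trans (hbx c hc)⟩

theorem pairing_eq_zero_of_before {f g x u : C00} (hfg : Before f g) (hg : StartsBefore g x)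
    (hu : u.support ⊆ x.support) : pairing f u = 0 := by
  obtain ⟨b, hb, hbx⟩ := hg
  exact pairing_eq_zero fun a ha hau =>
    lt_asymm (hfg.2.2 a ha b hb) (hbx a (hu hau))

theorem pairing_eq_zero_of_not_startsBefore {f x y u : C00} (hxy : Before x y)
    (hf : ¬StartsBefore f y) (hu : u.support ⊆ x.support) : pairing f u = 0 := by
  refine pairing_eq_zero fun a ha hau => hf ⟨a, ha, fun b hb => hxy.2.2 a (hu hau) b hb⟩

theorem pairing_list_sum_eq_zero {L : List C00} {u : C00} (h : ∀ f ∈ L, pairing f u = 0) :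
    pairing L.sum u = 0 := by
  rw [pairing_list_sum_left]
  refine List.sum_eq_zero fun t ht => ?_
  obtain ⟨f, hf, rfl⟩ := List.mem_map.1 ht
  exact h f hf

/-- Only the last of the functionals that start to the left of `x` can act on `x`. -/
theorem abs_pairing_sum_le_one_of_startsBefore {L : List C00} (hL : L.Pairwise Before) {x u : C00}
    (hu : u.support ⊆ x.support) (h : ∀ f ∈ L, |pairing f u| ≤ 1)
    (hs : ∀ f ∈ L, StartsBefore f x) : |pairing L.sum u| ≤ 1 := by
  induction L with
  | nil => simp [pairing_zero_left]
  | cons f L ih =>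
    rw [List.pairwise_cons] at hL
    rw [List.sum_cons, pairing_add_left]
    rcases L with _ | ⟨g, L⟩
    · simpa [pairing_zero_left] using h f (by simp)
    · rw [pairing_eq_zero_of_before (hL.1 g (by simp)) (hs g (by simp)) hu, zero_add]
      exact ih hL.2 (fun f hf => h f (List.mem_cons_of_mem _ hf))
        fun f hf => hs f (List.mem_cons_of_mem _ hf)

section Split
open Classical in
/-- The initial part of `L` consisting of the functionals that start to the left of `x`. -/
noncomputable def initialPart (x : C00) (L : List C00) : List C00 :=
  L.takeWhile fun f => StartsBefore f x

open Classical in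
/-- The remaining part of `L`. -/
noncomputable def finalPart (x : C00) (L : List C00) : List C00 :=
  L.dropWhile fun f => StartsBefore f x

theorem initialPart_append_finalPart (x : C00) (L : List C00) :
    initialPart x L ++ finalPart x L = L := List.takeWhile_append_dropWhile

theorem startsBefore_of_mem_initialPart {x f : C00} {L : List C00} (hf : f ∈ initialPart x L) :
    StartsBefore f x := by
  classical
  simpa using List.mem_takeWhile_imp hf

theorem not_startsBefore_of_mem_finalPart {x f : C00} {L : List C00} (hL : L.Pairwise Before)
    (hf : f ∈ finalPart x L) : ¬StartsBefore f x := by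
  classical
  induction L with
  | nil => simp [finalPart] at hf
  | cons g L ih =>
    rw [List.pairwise_cons] at hL
    by_cases hg : StartsBefore g x
    · refine ih hL.2 ?_
      simpa [finalPart, List.dropWhile_cons, hg] using hf
    · have hf' : f = g ∨ f ∈ L := by simpa [finalPart, List.dropWhile_cons, hg] using hf
      rcases hf' with rfl | hf'
      · exact hg
      · exact fun h => hg (h.of_before (hL.1 f hf'))

theorem mem_of_mem_initialPart {x f : C00} {L : List C00} (hf : f ∈ initialPart x L) : f ∈ L := by
  rw [← initialPart_append_finalPart x L]; exact List.mem_append_left _ hf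

theorem mem_of_mem_finalPart {x f : C00} {L : List C00} (hf : f ∈ finalPart x L) : f ∈ L := by
  rw [← initialPart_append_finalPart x L]; exact List.mem_append_right _ hf

theorem pairwise_initialPart {x : C00} {L : List C00} (hL : L.Pairwise Before) :
    (initialPart x L).Pairwise Before := by
  rw [← initialPart_append_finalPart x L] at hL
  exact (List.pairwise_append.1 hL).1

theorem pairing_sum_eq_initialPart_add_finalPart (x u : C00) (L : List C00) :
    pairing L.sum u = pairing (initialPart x L).sum u + pairing (finalPart x L).sum u := by
  conv_lhs => rw [← initialPart_append_finalPart x L, List.sum_append, pairing_add_left]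

theorem abs_pairing_initialPart_le_one {L : List C00} (hL : L.Pairwise Before) {x u : C00}
    (hu : u.support ⊆ x.support) (h : ∀ f ∈ L, |pairing f u| ≤ 1) :
    |pairing (initialPart x L).sum u| ≤ 1 :=
  abs_pairing_sum_le_one_of_startsBefore (pairwise_initialPart hL) hu
    (fun f hf => h f (mem_of_mem_initialPart hf)) fun _ hf => startsBefore_of_mem_initialPart hf

end Split

/-- A successive sequence of `d` functionals can act with more than one of its terms on at most
`d` members of a block sequence. -/
theorem card_le_length_of_one_lt_abs_pairing {ι : Type*} [LinearOrder ι] {x u : ι → C00}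
    {F : Finset ι} (hx : ∀ p ∈ F, ∀ p' ∈ F, p < p' → Before (x p) (x p'))
    (hu : ∀ p ∈ F, (u p).support ⊆ (x p).support) {L : List C00}
    (hL : L.Pairwise Before) (h1 : ∀ p ∈ F, ∀ f ∈ L, |pairing f (u p)| ≤ 1)
    (h2 : ∀ p ∈ F, 1 < |pairing L.sum (u p)|) : F.card ≤ L.length := by
  classical
  -- The terms starting left of `x p` contribute at most `1`, so some other term must reach `x p`.
  -- This term starts left of every later `x p'`, hence differs from the one chosen for `p'`.
  have key : ∀ p ∈ F, ∃ f ∈ L, ¬StartsBefore f (x p) ∧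
      ∃ a ∈ f.support, ∃ b ∈ (x p).support, a ≤ b := by
    intro p hp
    by_contra! hcon
    refine (h2 p hp).not_ge ?_
    rw [pairing_sum_eq_initialPart_add_finalPart (x p), pairing_list_sum_eq_zero (L := finalPart _ _),
      add_zero]
    · exact abs_pairing_initialPart_le_one hL (hu p hp) (h1 p hp)
    · intro f hf
      refine pairing_eq_zero fun a ha hau => ?_
      exact lt_irrefl a (hcon f (mem_of_mem_finalPart hf)
        (not_startsBefore_of_mem_finalPart hL hf) a ha a (hu p hp hau))
  choose! φ hφL hφ1 hφ2 using key
  have hlt : ∀ p ∈ F, ∀ p' ∈ F, p < p' → φ p ≠ φ p' := by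
    intro p hp p' hp' hpp h
    obtain ⟨a, ha, b, hb, hab⟩ := hφ2 p hp
    refine hφ1 p' hp' ⟨a, h ▸ ha, fun c hc => hab.trans_lt ((hx p hp p' hp' hpp).2.2 b hb c hc)⟩
  refine (Finset.card_le_card_of_injOn φ (t := L.toFinset) (fun p hp => by
    simpa using hφL p hp) ?_).trans (List.toFinset_card_le L)
  intro p hp p' hp' h
  rcases lt_trichotomy p p' with hpp | hpp | hpp
  · exact absurd h (hlt p hp p' hp' hpp)
  · exact hpp
  · exact absurd h.symm (hlt p' hp' p hp hpp)

/-! ### Special functionals acting on two vectors -/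

/-- `B ≠ []` excludes the first term of the sequence, whose weight is not coded by `σ`. -/
theorem IsSpecial.hasWeight_append {Ω₁ : Set ℕ} {σ : List C00 → ℕ} {j : ℕ} {B D : List C00}
    (h : IsSpecial Ω₁ σ j (B ++ D)) (hB : B ≠ []) {i : ℕ} (hi : i < D.length) :
    HasWeight G₀ (m (σ (B ++ D.take i))) D[i] := by
  have h1 : 1 ≤ B.length + i := by
    have := List.length_pos_iff.2 hB
    omega
  have := h.next (B.length + i) h1 (by simp; omega)
  simpa [List.take_append, List.take_of_length_le] using this

theorem append_take_mem_Qs {B D : List C00} (h : B ++ D ∈ Qs) (hB : B ≠ []) (i : ℕ) :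
    B ++ D.take i ∈ Qs := by
  have hsub : (B ++ D.take i).Sublist (B ++ D) :=
    (List.Sublist.refl B).append (List.take_sublist i D)
  exact ⟨⟨by simp [hB], fun f hf => h.1.2.1 f (hsub.subset hf), h.1.2.2.sublist hsub⟩,
    fun f hf => h.2 f (hsub.subset hf)⟩

theorem sum_range_getD {M : Type*} [AddCommMonoid M] (l : List M) {N : ℕ} (h : l.length ≤ N) :
    ∑ i ∈ Finset.range N, l.getD i 0 = l.sum := by
  induction l generalizing N with
  | nil => simp
  | cons a l ih =>
    obtain ⟨N, rfl⟩ : ∃ N', N = N' + 1 := ⟨N - 1, by simp at h; omega⟩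
    rw [Finset.sum_range_succ', List.sum_cons, ← ih (N := N) (by simpa using h), add_comm]
    simp

open Classical in
/-- Some restriction of a special sequence of index `j` takes values larger than `c` at both `x`
and `y`. -/
def HitBoth (Ω₁ : Set ℕ) (σ : List C00 → ℕ) (j : ℕ) (c : ℝ) (x y : C00) : Prop :=
  ∃ L, IsSpecial Ω₁ σ j L ∧ ∃ P : ℕ+ → Prop,
    c < |pairing L.sum (x.filter P)| ∧ c < |pairing L.sum (y.filter P)|

section
open Classical

/-- Special sequences that branch before `x` use different weights on `x`; hence only boundedly
many of them can act on `x`. -/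
theorem card_lt_of_injOn_initialPart {Ω₁ Ω₂ : Set ℕ} {σ : List C00 → ℕ} (hσ : IsCoding Ω₁ Ω₂ σ)
    {ι : Type*} {j : ℕ} {x : C00} (hx : ∀ g ∈ G₀, |pairing g x| ≤ 1) {F : Finset ι}
    {L : ι → List C00} {P : ι → ℕ+ → Prop} (hL : ∀ p ∈ F, IsSpecial Ω₁ σ j (L p))
    (hinj : Set.InjOn (fun p => initialPart x (L p)) F) (hne : ∀ p ∈ F, initialPart x (L p) ≠ [])
    (hval : ∀ p ∈ F, 1 < |pairing (finalPart x (L p)).sum (x.filter (P p))|) :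
    F.card < n (2 * j + 1) := by
  by_contra! hcard
  obtain ⟨E, hEF, hE⟩ := Finset.exists_subset_card_eq hcard
  have hN0 : 0 < n (2 * j + 1) := n_pos _
  obtain ⟨N, hN⟩ : ∃ N, N = n (2 * j + 1) := ⟨_, rfl⟩
  rw [← hN] at hE hN0
  have hNR : (0 : ℝ) < N := by exact_mod_cast hN0
  set B := fun p => initialPart x (L p)
  set D := fun p => finalPart x (L p)
  have hLBD : ∀ p, B p ++ D p = L p := fun p => initialPart_append_finalPart x (L p)
  have hDlen : ∀ p ∈ E, (D p).length ≤ N := by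
    intro p hp
    rw [hN, ← (hL p (hEF hp)).length_eq, ← hLBD p, List.length_append]
    omega
  obtain ⟨s, hs, hs2⟩ : ∃ s : ι → ℚ, (∀ p, (s p : ℝ) * pairing (D p).sum (x.filter (P p)) =
      |pairing (D p).sum (x.filter (P p))|) ∧ ∀ p, s p ^ 2 = 1 := by
    refine ⟨fun p => if 0 ≤ pairing (D p).sum (x.filter (P p)) then 1 else -1, fun p => ?_,
      fun p => by dsimp only; split_ifs <;> norm_num⟩
    by_cases h : 0 ≤ pairing (D p).sum (x.filter (P p))
    · simp [h, abs_of_nonneg h]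
    · simp [h, abs_of_neg (not_le.1 h)]
  obtain ⟨f, hf⟩ : ∃ f : ι × ℕ → C00, ∀ q, f q = ((D q.1).getD q.2 0).filter (P q.1) :=
    ⟨_, fun _ => rfl⟩
  obtain ⟨w, hwdef⟩ : ∃ w : ι × ℕ → ℕ, ∀ q, w q = m (σ (B q.1 ++ (D q.1).take q.2)) :=
    ⟨_, fun _ => rfl⟩
  have hlen : ∀ q, f q ≠ 0 → q.2 < (D q.1).length := by
    intro q hq
    by_contra! h
    exact hq (by simp [hf, List.getElem?_eq_none h, Finsupp.filter_zero])
  -- There are `N` sequences with at most `N` final terms each; the coefficients `± 1 / N` on this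
  -- `N × N` array have squares summing to `1`.
  have hmem : (∑ q ∈ E ×ˢ Finset.range N, ((s q.1 / N : ℚ) : ℝ) • f q) ∈ G₀ := by
    have ha : ∑ q ∈ E ×ˢ Finset.range N, (s q.1 / N) ^ 2 ≤ 1 := by
      rw [Finset.sum_product]
      simp only [div_pow, hs2, Finset.sum_const, Finset.card_range, hE, nsmul_eq_mul]
      have : (N : ℚ) ≠ 0 := by exact_mod_cast hN0.ne'
      field_simp
      exact le_rfl
    have hfw : ∀ q ∈ E ×ˢ Finset.range N, f q ≠ 0 → HasWeight G₀ (w q) (f q) := by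
      rintro ⟨p, i⟩ hq h0
      have hp : p ∈ E := (Finset.mem_product.1 hq).1
      have hi : i < (D p).length := hlen _ h0
      have hsp := hL p (hEF hp)
      rw [← hLBD p] at hsp
      have hw := hsp.hasWeight_append (hne p (hEF hp)) hi
      have hfi : f (p, i) = (D p)[i].filter (P p) := by
        simp [hf, List.getElem?_eq_getElem hi]
      rw [hfi] at h0 ⊢
      rw [hwdef]
      exact hw.filter (P p) (fun g hg => filter_mem_G₀ _ hg) h0
    have hwinj : Set.InjOn w {q | q ∈ E ×ˢ Finset.range N ∧ f q ≠ 0} := by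
      rintro ⟨p, i⟩ ⟨hq, h0⟩ ⟨p', i'⟩ ⟨hq', h0'⟩ hww
      have hp : p ∈ E := (Finset.mem_product.1 hq).1
      have hp' : p' ∈ E := (Finset.mem_product.1 hq').1
      have hQ : ∀ p ∈ E, ∀ i, B p ++ (D p).take i ∈ Qs := fun p hp i =>
        append_take_mem_Qs ((hLBD p).symm ▸ (hL p (hEF hp)).mem) (hne p (hEF hp)) i
      rw [hwdef, hwdef] at hww
      have heq : B p ++ (D p).take i = B p' ++ (D p').take i' :=
        hσ.injOn (hQ p hp i) (hQ p' hp' i') (m_strictMono.injective hww)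
      -- The initial part can be read off from the coded prefix, so equal prefixes force equal `p`;
      -- comparing lengths then gives equal positions.
      have hfilter : ∀ p ∈ E, ∀ i, (B p ++ (D p).take i).filter (fun f => StartsBefore f x) = B p := by
        intro p hp i
        rw [List.filter_append, List.filter_eq_self.2, List.filter_eq_nil_iff.2, List.append_nil]
        · intro f hf
          simpa using not_startsBefore_of_mem_finalPart (hL p (hEF hp)).mem.1.2.2
            (List.mem_of_mem_take hf)
        · intro f hf
          simpa using startsBefore_of_mem_initialPart hf
      have hBB : B p = B p' := by rw [← hfilter p hp i, heq, hfilter p' hp' i']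
      obtain rfl : p = p' := hinj (hEF hp) (hEF hp') hBB
      have hll := congrArg List.length heq
      have hi : i < (D p).length := hlen _ h0
      have hi' : i' < (D p).length := hlen _ h0'
      simp only [List.length_append, List.length_take] at hll
      exact Prod.ext rfl (by simp only; omega)
    exact sum_mem_G₀ (E ×ˢ Finset.range N) (fun q => s q.1 / N) f w ha hfw hwinj
  have hle := hx _ hmem
  have hcalc : pairing (∑ q ∈ E ×ˢ Finset.range N, ((s q.1 / N : ℚ) : ℝ) • f q) x =
      ∑ p ∈ E, |pairing (D p).sum (x.filter (P p))| / N := by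
    rw [Finset.sum_product, pairing_sum_left]
    refine Finset.sum_congr rfl fun p hp => ?_
    rw [pairing_sum_left]
    simp only [pairing_smul_left, hf, pairing_filter]
    have hD : ∑ i ∈ Finset.range N, pairing ((D p).getD i 0) (x.filter (P p)) =
        pairing (D p).sum (x.filter (P p)) := by
      rw [← sum_range_getD _ (hDlen p hp)]
      exact (pairing_sum_left _ _ _).symm
    rw [← Finset.mul_sum]
    refine (congrArg _ hD).trans ?_
    rw [← hs p]
    push_cast
    ring
  have hlt : ∑ p ∈ E, 1 / (N : ℝ) < ∑ p ∈ E, |pairing (D p).sum (x.filter (P p))| / N := by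
    refine Finset.sum_lt_sum_of_nonempty (Finset.card_pos.1 (hE ▸ hN0)) fun p hp => ?_
    exact div_lt_div_of_pos_right (hval p (hEF hp)) hNR
  rw [Finset.sum_const, hE, nsmul_eq_mul, mul_one_div_cancel hNR.ne'] at hlt
  exact absurd (hlt.trans_le (hcalc ▸ le_abs_self _)) (not_lt.2 hle)

/-- Group the witnessing sequences by their part starting left of `x p'`. Only this part acts on the
earlier `x p`, which bounds each group; the remaining parts bound the number of groups. The
hypothesis `2 ≤ c` leaves more than `1` for the remaining part at `x p'`, since the initial part
takes at most `1` there. -/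
theorem card_hitBoth_le {Ω₁ Ω₂ : Set ℕ} {σ : List C00 → ℕ} (hσ : IsCoding Ω₁ Ω₂ σ)
    {ι : Type*} [LinearOrder ι] {x : ι → C00} (hx : ∀ p p', p < p' → Before (x p) (x p'))
    (hn : ∀ p, ∀ g ∈ G₀, |pairing g (x p)| ≤ 1) {j : ℕ} {c : ℝ} (hc : 2 ≤ c) (p' : ι)
    (F : Finset ι) (hF : ∀ p ∈ F, p < p' ∧ HitBoth Ω₁ σ j c (x p) (x p')) :
    F.card ≤ n (2 * j + 1) * n (2 * j + 1) := by
  choose! hlt L hL P hP hP' using hF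
  have hact : ∀ p, ∀ (Q : ℕ+ → Prop), ∀ g ∈ G₀, |pairing g ((x p).filter Q)| ≤ 1 := by
    intro p Q g hg
    rw [← pairing_filter]
    exact hn p _ (filter_mem_G₀ Q hg)
  have hini : ∀ p ∈ F, 1 < |pairing (initialPart (x p') (L p)).sum ((x p).filter (P p))| := by
    intro p hp
    have h := hP p hp
    rw [pairing_sum_eq_initialPart_add_finalPart (x p'),
      pairing_list_sum_eq_zero (L := finalPart _ _), add_zero] at h
    · linarith
    · exact fun f hf => pairing_eq_zero_of_not_startsBefore (hx p p' (hlt p hp))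
        (not_startsBefore_of_mem_finalPart (hL p hp).mem.1.2.2 hf) (support_filter_subset _ _)
  have hfin : ∀ p ∈ F, 1 < |pairing (finalPart (x p') (L p)).sum ((x p').filter (P p))| := by
    intro p hp
    have h := hP' p hp
    rw [pairing_sum_eq_initialPart_add_finalPart (x p')] at h
    have h1 := abs_pairing_initialPart_le_one (hL p hp).mem.1.2.2
      (support_filter_subset (P p) (x p')) fun f hf => hact p' (P p) f ((hL p hp).mem.2 f hf)
    have h2 := abs_add_le (pairing (initialPart (x p') (L p)).sum ((x p').filter (P p)))
      (pairing (finalPart (x p') (L p)).sum ((x p').filter (P p)))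
    linarith
  have hne : ∀ p ∈ F, initialPart (x p') (L p) ≠ [] := by
    intro p hp h
    have := hini p hp
    rw [h] at this
    simp [pairing_zero_left] at this
    linarith
  set B := fun p => initialPart (x p') (L p)
  have hfib : ∀ b ∈ F.image B, (F.filter fun p => B p = b).card ≤ n (2 * j + 1) := by
    intro b hb
    obtain ⟨p₀, hp₀, rfl⟩ := Finset.mem_image.1 hb
    have hlen : (B p₀).length ≤ n (2 * j + 1) := by
      rw [← (hL p₀ hp₀).length_eq, ← initialPart_append_finalPart (x p') (L p₀), List.length_append]
      exact Nat.le_add_right _ _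
    refine le_trans (card_le_length_of_one_lt_abs_pairing (x := x)
      (u := fun p => (x p).filter (P p)) (fun p _ p' _ h => hx p p' h)
      (fun p _ => support_filter_subset _ _)
      (pairwise_initialPart (hL p₀ hp₀).mem.1.2.2) ?_ ?_) hlen
    · exact fun p _ f hf => hact p (P p) f ((hL p₀ hp₀).mem.2 f (mem_of_mem_initialPart hf))
    · intro p hp
      obtain ⟨hp, hpb⟩ := Finset.mem_filter.1 hp
      change 1 < |pairing (B p₀).sum _|
      rw [← hpb]
      exact hini p hp
  have himg : (F.image B).card ≤ n (2 * j + 1) := by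
    -- One representative for each initial part.
    obtain ⟨E, hEF, hEinj, hEB⟩ := Finset.exists_subset_injOn_image_eq_of_surjOn (F : Set ι)
      (F.image B) (f := B) (by rw [Finset.coe_image]; exact Set.surjOn_image B _)
    rw [← hEB, Finset.card_image_of_injOn hEinj]
    exact (card_lt_of_injOn_initialPart hσ (hn p') (fun p hp => hL p (hEF hp)) hEinj
      (fun p hp => hne p (hEF hp)) fun p hp => hfin p (hEF hp)).le
  exact (Finset.card_le_mul_card_image F _ hfib).trans (Nat.mul_le_mul_left _ himg)

end

/-! ### Extraction of subsequences -/

/-- Greedy colouring: at most `D` earlier neighbours leave one of `D + 1` colours free. The default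
`0` in the recursion is never used. -/
theorem exists_coloring {R : ℕ → ℕ → Prop} {D : ℕ}
    (h : ∀ p' (F : Finset ℕ), (∀ p ∈ F, p < p' ∧ R p p') → F.card ≤ D) :
    ∃ c : ℕ → Fin (D + 1), ∀ p p', p < p' → R p p' → c p ≠ c p' := by
  classical
  let step : (p' : ℕ) → ((p : ℕ) → p < p' → Fin (D + 1)) → Fin (D + 1) := fun p' ih =>
    if h : ∃ col, ∀ p (hp : p < p'), R p p' → ih p hp ≠ col then h.choose else 0
  let c : ℕ → Fin (D + 1) := WellFounded.fix Nat.lt_wfRel.wf step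
  have hc : ∀ p', c p' = step p' fun p _ => c p := fun p' => WellFounded.fix_eq _ _ _
  refine ⟨c, fun p p' hp hR => ?_⟩
  have hex : ∃ col, ∀ p, p < p' → R p p' → c p ≠ col := by
    have hcard := h p' ((Finset.range p').filter fun p => R p p') (by simp)
    obtain ⟨col, hcol⟩ : ∃ col, col ∉ ((Finset.range p').filter fun p => R p p').image c := by
      by_contra! hall
      have := Finset.card_le_card (fun col _ => hall col : Finset.univ ⊆ _)
      have := this.trans Finset.card_image_le
      simp only [Finset.card_univ, Fintype.card_fin] at this
      omega
    refine ⟨col, fun p hp hR h => hcol ?_⟩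
    exact Finset.mem_image.2 ⟨p, by simp [hp, hR], h⟩
  rw [hc p']
  simp only [step, dif_pos hex]
  exact hex.choose_spec p hp hR

theorem exists_infinite_independent {R : ℕ → ℕ → Prop} {D : ℕ}
    (h : ∀ p' (F : Finset ℕ), (∀ p ∈ F, p < p' ∧ R p p') → F.card ≤ D) {S : Set ℕ}
    (hS : S.Infinite) :
    ∃ T ⊆ S, T.Infinite ∧ ∀ p ∈ T, ∀ p' ∈ T, p < p' → ¬R p p' := by
  obtain ⟨c, hc⟩ := exists_coloring h
  obtain ⟨col, hcol⟩ : ∃ col, (S ∩ c ⁻¹' {col}).Infinite := by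
    by_contra! hfin
    refine hS ((Set.finite_iUnion hfin).subset fun p hp => ?_)
    exact Set.mem_iUnion.2 ⟨c p, hp, rfl⟩
  refine ⟨_, Set.inter_subset_left, hcol, fun p hp p' hp' hlt hR => hc p p' hlt hR ?_⟩
  rw [hp.2, hp'.2]

/-- Diagonal argument: after choosing `r`, thin the infinite reservoir so that it is independent for
the finitely many relations of index below `J r`, whose union still has bounded back-degree. -/
theorem exists_strictMono_independent {R : ℕ → ℕ → ℕ → Prop} {D : ℕ → ℕ}
    (h : ∀ j p' (F : Finset ℕ), (∀ p ∈ F, p < p' ∧ R j p p') → F.card ≤ D j) (J : ℕ → ℕ) :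
    ∃ φ : ℕ → ℕ, StrictMono φ ∧
      ∀ a b c, a < b → b < c → ∀ j < J (φ a), ¬R j (φ b) (φ c) := by
  classical
  have hstep : ∀ s : {s : ℕ × Set ℕ // s.2.Infinite}, ∃ s' : {s : ℕ × Set ℕ // s.2.Infinite},
      s'.1.1 ∈ s.1.2 ∧ s.1.1 < s'.1.1 ∧ s'.1.2 ⊆ s.1.2 ∧
      ∀ p ∈ s'.1.2, ∀ p' ∈ s'.1.2, p < p' → ∀ j < J s'.1.1, ¬R j p p' := by
    rintro ⟨⟨q, S⟩, hS⟩
    obtain ⟨r, hr, hqr⟩ := hS.exists_gt q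
    have hdeg : ∀ p' (F : Finset ℕ), (∀ p ∈ F, p < p' ∧ ∃ j < J r, R j p p') →
        F.card ≤ ∑ j ∈ Finset.range (J r), D j := by
      intro p' F hF
      have hsub : F ⊆ (Finset.range (J r)).biUnion fun j => F.filter fun p => R j p p' := by
        intro p hp
        obtain ⟨-, j, hj, hR⟩ := hF p hp
        exact Finset.mem_biUnion.2 ⟨j, Finset.mem_range.2 hj, Finset.mem_filter.2 ⟨hp, hR⟩⟩
      refine (Finset.card_le_card hsub).trans (Finset.card_biUnion_le.trans ?_)
      refine Finset.sum_le_sum fun j _ => h j p' _ fun p hp => ?_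
      exact ⟨(hF p (Finset.mem_filter.1 hp).1).1, (Finset.mem_filter.1 hp).2⟩
    obtain ⟨T, hTS, hT, hind⟩ := exists_infinite_independent hdeg hS
    exact ⟨⟨⟨r, T⟩, hT⟩, hr, hqr, hTS, fun p hp p' hp' hlt j hj hR => hind p hp p' hp' hlt ⟨j, hj, hR⟩⟩
  choose next h1 h2 h3 h4 using hstep
  let seq : ℕ → {s : ℕ × Set ℕ // s.2.Infinite} := fun k =>
    Nat.rec ⟨(0, Set.univ), Set.infinite_univ⟩ (fun _ s => next s) k
  have hseq : ∀ k, seq (k + 1) = next (seq k) := fun k => rfl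
  have hanti : Antitone fun k => (seq k).1.2 := antitone_nat_of_succ_le fun k => by
    simp only [hseq]; exact h3 _
  have hmem : ∀ a b, a < b → (seq (b + 1)).1.1 ∈ (seq (a + 1)).1.2 := fun a b hab =>
    hanti (Nat.succ_le_of_lt hab) (by simp only [hseq b]; exact h1 _)
  -- The shift discards the dummy starting value `0`.
  refine ⟨fun k => (seq (k + 1)).1.1, strictMono_nat_of_lt_succ fun k => ?_, ?_⟩
  · simp only [hseq (k + 1)]; exact h2 _
  · intro a b c hab hbc j hj
    refine h4 (seq a) _ (hmem a b hab) _ (hmem a c (hab.trans hbc)) ?_ j hj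
    refine (strictMono_nat_of_lt_succ (f := fun k => (seq k).1.1) fun k => ?_) (Nat.succ_lt_succ hbc)
    simp only [hseq k]; exact h2 _


open Classical in
/-- Every block sequence has a subsequence such that special functionals of large index act on at
most two of its members. -/
theorem exists_subseq_card_le_two {Ω₁ Ω₂ : Set ℕ} {σ : List C00 → ℕ} (hσ : IsCoding Ω₁ Ω₂ σ)
    {x : ℕ → C00} (hx : IsBlockSeq x) (hn : ∀ p, ∀ g ∈ G₀, |pairing g (x p)| ≤ 1)
    {δ : ℝ} (hδ : 0 < δ) {q : ℕ} (hq : ∀ j, q ≤ j → 2 ≤ δ * m (2 * j + 1)) :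
    ∃ φ : ℕ → ℕ, StrictMono φ ∧ ∀ j, q ≤ j → ∀ L, IsSpecial Ω₁ σ j L → ∀ P : ℕ+ → Prop,
      ∀ F : Finset ℕ,
        (∀ p ∈ F, δ * m (2 * j + 1) < |pairing L.sum ((x (φ p)).filter P)|) → F.card ≤ 2 := by
  -- For fixed `x p` the values are bounded by its `ℓ¹`-norm, while `m (2 * j + 1)` tends to
  -- infinity.
  have hJ : ∀ p, ∃ J : ℕ, ∀ j, J ≤ j → ∀ L, IsSpecial Ω₁ σ j L → ∀ P : ℕ+ → Prop,
      |pairing L.sum ((x p).filter P)| ≤ δ * m (2 * j + 1) := by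
    intro p
    obtain ⟨J, hJ⟩ := exists_nat_ge ((∑ i ∈ (x p).support, |x p i|) / δ)
    refine ⟨J, fun j hj L hL P => ?_⟩
    rw [← pairing_filter]
    refine (abs_pairing_le fun i => hL.abs_filter_apply_le P i).trans ?_
    rw [one_mul, mul_comm, ← div_le_iff₀ hδ]
    refine hJ.trans ?_
    have := m_strictMono.le_apply (x := 2 * j + 1)
    exact_mod_cast (show J ≤ m (2 * j + 1) by omega)
  choose J hJ using hJ
  obtain ⟨φ, hφ, hind⟩ := exists_strictMono_independent
    (R := fun j p p' => q ≤ j ∧ HitBoth Ω₁ σ j (δ * m (2 * j + 1)) (x p) (x p'))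
    (D := fun j => n (2 * j + 1) * n (2 * j + 1)) (fun j p' F hF => by
      rcases F.eq_empty_or_nonempty with rfl | ⟨p₀, hp₀⟩
      · simp
      · exact card_hitBoth_le hσ (fun p p' h => hx.before h) hn (hq j (hF p₀ hp₀).2.1) p' F
          fun p hp => ⟨(hF p hp).1, (hF p hp).2.2⟩) J
  refine ⟨φ, hφ, fun j hj L hL P F hF => ?_⟩
  by_contra! hcard
  have hne : F.Nonempty := Finset.card_pos.1 (by omega)
  set a := F.min' hne with ha
  have haF : a ∈ F := F.min'_mem hne
  -- A hit at the least member `a` forces `j < J (φ a)`, and for such `j` no two later members are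
  -- hit together.
  have key : ∀ b ∈ F, ∀ c ∈ F, a ≠ b → b < c → False := by
    intro b hb c hc hab hbc
    have hab' : a < b := lt_of_le_of_ne (F.min'_le b hb) hab
    refine hind a b c hab' hbc j ?_ ⟨hj, L, hL, P, hF b hb, hF c hc⟩
    by_contra! hJj
    exact (hF a haF).not_ge (hJ _ j hJj L hL P)
  obtain ⟨b, hb, c, hc, hbc⟩ := Finset.one_lt_card.1
    (show 1 < (F.erase a).card by rw [Finset.card_erase_of_mem haF]; omega)
  rw [Finset.mem_erase] at hb hc
  rcases lt_or_gt_of_ne hbc with h | h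
  · exact key b hb.2 c hc.2 hb.1.symm h
  · exact key c hc.2 b hb.2 hc.1.symm h

/-! ### Iterated averages -/

/-- Iterated averages of `k` consecutive terms, multiplied by `2` at each step. -/
noncomputable def iterAvg (k : ℕ) (x : ℕ → C00) : ℕ → ℕ → C00
  | 0, i => x i
  | t + 1, i => (2 / (k : ℝ)) • ∑ r ∈ Finset.range k, iterAvg k x t (k * i + r)

section IterAvg
variable {k : ℕ} {x : ℕ → C00}

theorem iterAvg_mem_span (t i : ℕ) : iterAvg k x t i ∈ Submodule.span ℝ (Set.range x) := by
  induction t generalizing i with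
  | zero => exact Submodule.subset_span ⟨i, rfl⟩
  | succ t ih => exact Submodule.smul_mem _ _ (Submodule.sum_mem _ fun r _ => ih _)

/-- The vector `x p` enters the level-`t` average with index `p / k ^ t`; this makes the bookkeeping
consistent from one level to the next. -/
theorem div_pow_succ_eq {t i p r : ℕ} (hr : r < k) (h : p / k ^ t = k * i + r) :
    p / k ^ (t + 1) = i := by
  rw [pow_succ, ← Nat.div_div_eq_div_mul, h, Nat.mul_add_div (by omega), Nat.div_eq_of_lt hr,
    add_zero]

theorem exists_of_mem_support_iterAvg {t i : ℕ} {a : ℕ+} (ha : a ∈ (iterAvg k x t i).support) :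
    ∃ p, p / k ^ t = i ∧ a ∈ (x p).support := by
  induction t generalizing i with
  | zero => exact ⟨i, by simp, ha⟩
  | succ t ih =>
    have hsum := Finsupp.support_smul ha
    obtain ⟨r, hr, har⟩ : ∃ r ∈ Finset.range k, a ∈ (iterAvg k x t (k * i + r)).support := by
      by_contra! h
      rw [Finsupp.mem_support_iff, Finsupp.finsetSum_apply] at hsum
      exact hsum (Finset.sum_eq_zero fun r hr => Finsupp.notMem_support_iff.1 (h r hr))
    obtain ⟨p, hp, hap⟩ := ih har
    exact ⟨p, div_pow_succ_eq (Finset.mem_range.1 hr) hp, hap⟩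

theorem le_pairing_iterAvg (hk : 0 < k) {G : C00} {c : ℝ} {t i : ℕ}
    (h : ∀ p, p / k ^ t = i → c ≤ pairing G (x p)) :
    2 ^ t * c ≤ pairing G (iterAvg k x t i) := by
  induction t generalizing i with
  | zero => simpa [iterAvg] using h i (by simp)
  | succ t ih =>
    have hkR : (0 : ℝ) < k := by exact_mod_cast hk
    rw [iterAvg, pairing_smul_right, pairing_sum_right]
    calc (2 : ℝ) ^ (t + 1) * c = 2 / k * ∑ r ∈ Finset.range k, 2 ^ t * c := by
          rw [Finset.sum_const, Finset.card_range, nsmul_eq_mul]; field_simp; ring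
      _ ≤ _ := by
          refine mul_le_mul_of_nonneg_left (Finset.sum_le_sum fun r hr => ih fun p hp => ?_)
            (by positivity)
          exact h p (div_pow_succ_eq (Finset.mem_range.1 hr) hp)

theorem abs_pairing_iterAvg_le (hk : 0 < k) {f : C00} {c : ℝ} {t i : ℕ}
    (h : ∀ p, p / k ^ t = i → |pairing f (x p)| ≤ c) :
    |pairing f (iterAvg k x t i)| ≤ 2 ^ t * c := by
  have h1 : 2 ^ t * -c ≤ pairing f (iterAvg k x t i) :=
    le_pairing_iterAvg hk fun p hp => (abs_le.1 (h p hp)).1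
  have h2 : 2 ^ t * -c ≤ pairing (-f) (iterAvg k x t i) :=
    le_pairing_iterAvg hk fun p hp => by
      rw [pairing_neg_left]; exact neg_le_neg (abs_le.1 (h p hp)).2
  rw [pairing_neg_left] at h2
  exact abs_le.2 ⟨by linarith, by linarith⟩

theorem disjoint_support_of_before {f g : C00} (h : Before f g) {a : ℕ+} (ha : a ∈ f.support) :
    a ∉ g.support := fun hb => lt_irrefl a (h.2.2 a ha a hb)

/-- Biorthogonal functionals in `G₀` for a block sequence that is bounded below. -/
theorem exists_functionals {ε : ℝ} (hx : IsBlockSeq x) (hε : ∀ p, ε < normOf G₀ (x p)) :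
    ∃ g : ℕ → C00, (∀ p, g p ∈ G₀) ∧ (∀ p, (g p).support ⊆ (x p).support) ∧
      ∀ N p, p < N → ε ≤ pairing (∑ l ∈ Finset.range N, g l) (x p) := by
  classical
  choose g hg hgx using fun p => exists_lt_pairing_of_lt_normOf_G₀ (hε p)
  have hself : ∀ p, (x p).filter (· ∈ (x p).support) = x p := fun p => by
    ext i
    by_cases h : i ∈ (x p).support
    · rw [Finsupp.filter_apply_pos _ _ h]
    · rw [Finsupp.filter_apply_neg _ _ h, Finsupp.notMem_support_iff.1 h]
  have hsupp : ∀ p, ((g p).filter (· ∈ (x p).support)).support ⊆ (x p).support := fun p a ha => by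
    rw [Finsupp.support_filter] at ha
    exact (Finset.mem_filter.1 ha).2
  refine ⟨fun p => (g p).filter (· ∈ (x p).support), fun p => filter_mem_G₀ _ (hg p), hsupp,
    fun N p hp => ?_⟩
  rw [pairing_sum_left, Finset.sum_eq_single p]
  · rw [pairing_filter, hself]; exact (hgx p).le
  · intro l _ hl
    refine pairing_eq_zero fun a ha hax => ?_
    rcases lt_or_gt_of_ne hl with h | h
    · exact disjoint_support_of_before (hx.before h) (hsupp l ha) hax
    · exact disjoint_support_of_before (hx.before h) hax (hsupp l ha)
  · exact fun h => absurd (Finset.mem_range.2 hp) h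

theorem iterAvg_ne_zero {ε : ℝ} (hε0 : 0 < ε) (hx : IsBlockSeq x)
    (hε : ∀ p, ε < normOf G₀ (x p)) (hk : 0 < k) (t i : ℕ) : iterAvg k x t i ≠ 0 := by
  obtain ⟨g, -, -, hg⟩ := exists_functionals hx hε
  intro h0
  have := le_pairing_iterAvg (x := x) (t := t) (i := i) hk
    (G := ∑ l ∈ Finset.range ((i + 1) * k ^ t), g l) (c := ε) fun p hp =>
      hg _ p (by
        rw [← Nat.div_lt_iff_lt_mul (by positivity)]; omega)
  rw [h0, pairing_comm, pairing_zero_left] at this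
  have h2 : (0 : ℝ) < 2 ^ t * ε := by positivity
  linarith

theorem iterAvg_before {ε : ℝ} (hε0 : 0 < ε) (hx : IsBlockSeq x)
    (hε : ∀ p, ε < normOf G₀ (x p)) (hk : 0 < k) (t : ℕ) {i i' : ℕ} (hii : i < i') :
    Before (iterAvg k x t i) (iterAvg k x t i') := by
  refine ⟨iterAvg_ne_zero hε0 hx hε hk t i, iterAvg_ne_zero hε0 hx hε hk t i', fun a ha b hb => ?_⟩
  obtain ⟨p, hp, hap⟩ := exists_of_mem_support_iterAvg ha
  obtain ⟨p', hp', hbp⟩ := exists_of_mem_support_iterAvg hb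
  refine (hx.before ?_).2.2 a hap b hbp
  by_contra! h
  have := Nat.div_le_div_right (c := k ^ t) h
  omega

theorem sum_map_range {M : Type*} [AddCommMonoid M] (g : ℕ → M) (N : ℕ) :
    ((List.range N).map g).sum = ∑ l ∈ Finset.range N, g l := by
  induction N with
  | zero => simp
  | succ N ih => rw [List.range_succ, List.map_append, List.sum_append, ih, Finset.sum_range_succ]; simp

/-- The operations of `G₀` give a lower estimate for iterated averages. -/
theorem le_normOf_G₀_iterAvg {ε : ℝ} (hε0 : 0 < ε) (hx : IsBlockSeq x)
    (hε : ∀ p, ε < normOf G₀ (x p)) (hk : 0 < k) {T q : ℕ} (hq : 1 ≤ q)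
    (hT : k ^ T ≤ n (2 * q)) : 1 / (m (2 * q) : ℝ) * (2 ^ T * ε) ≤ normOf G₀ (iterAvg k x T 0) := by
  obtain ⟨g, hgG, hgs, hg⟩ := exists_functionals hx hε
  have hkT : 0 < k ^ T := by positivity
  have hg0 : ∀ p, g p ≠ 0 := by
    intro p h0
    have h1 := hg (p + 1) p (Nat.lt_succ_self p)
    rw [pairing_sum_left, Finset.sum_eq_single p, h0, pairing_zero_left] at h1
    · linarith
    · intro l hl hlp
      have hlt : l < p := by
        have := Finset.mem_range.1 hl
        omega
      exact pairing_eq_zero fun a ha =>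
        disjoint_support_of_before (hx.before hlt) (hgs l ha)
    · intro h; simp at h
  have hmem : (1 / (m (2 * q) : ℝ)) • ((List.range (k ^ T)).map g).sum ∈ G₀ := by
    refine gClosed_G₀.op q hq _ ⟨?_, ?_, ?_⟩ (by simpa using hT) ?_
    · simpa using hkT.ne'
    · intro f hf
      obtain ⟨p, -, rfl⟩ := List.mem_map.1 hf
      exact hg0 p
    · rw [List.pairwise_map]
      refine List.pairwise_lt_range.imp fun {p p'} h => ⟨hg0 p, hg0 p', fun a ha b hb => ?_⟩
      exact (hx.before h).2.2 a (hgs p ha) b (hgs p' hb)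
    · intro f hf
      obtain ⟨p, -, rfl⟩ := List.mem_map.1 hf
      exact hgG p
  refine le_trans ?_ ((le_abs_self _).trans (abs_pairing_le_normOf_G₀ hmem _))
  rw [pairing_smul_left, sum_map_range]
  refine mul_le_mul_of_nonneg_left (le_pairing_iterAvg hk fun p hp => hg _ p ?_) (by positivity)
  exact (Nat.div_eq_zero_iff_lt hkT).1 hp

end IterAvg

/-! ### The main estimates -/

theorem abs_average_le {k : ℕ} (hk : 0 < k) {v : ℕ → ℝ} {c d : ℝ} (hc : 0 ≤ c)
    (hv : ∀ r < k, |v r| ≤ 1)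
    (hd : (((Finset.range k).filter fun r => c < |v r|).card : ℝ) ≤ d) :
    |1 / (k : ℝ) * ∑ r ∈ Finset.range k, v r| ≤ d / k + c := by
  have hkR : (0 : ℝ) < k := by exact_mod_cast hk
  have h : ∑ r ∈ Finset.range k, |v r| ≤ d + k * c := by
    calc ∑ r ∈ Finset.range k, |v r|
        ≤ ∑ r ∈ Finset.range k, ((if c < |v r| then 1 else 0) + c) := by
          refine Finset.sum_le_sum fun r hr => ?_
          split_ifs with h
          · linarith [hv r (Finset.mem_range.1 hr)]
          · linarith
      _ = (((Finset.range k).filter fun r => c < |v r|).card : ℝ) + k * c := by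
          rw [Finset.sum_add_distrib]; simp
      _ ≤ d + k * c := by linarith
  rw [abs_mul, abs_of_pos (by positivity)]
  calc 1 / (k : ℝ) * |∑ r ∈ Finset.range k, v r| ≤ 1 / (k : ℝ) * (d + k * c) :=
        mul_le_mul_of_nonneg_left ((Finset.abs_sum_le_sum_abs _ _).trans h) (by positivity)
    _ = d / k + c := by field_simp

/-- If the `W₀`-norm of `y` exceeds a bound for all special functionals, then it equals the
`G₀`-norm. -/
theorem normOf_G₀_eq_normOf_W₀ {Ω₁ : Set ℕ} {σ : List C00 → ℕ} {y : C00} {c : ℝ}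
    (hc : c < normOf (W₀ Ω₁ σ) y) (h : ∀ f ∈ W₀ Ω₁ σ, f ∉ G₀ → |pairing f y| ≤ c) :
    normOf G₀ y = normOf (W₀ Ω₁ σ) y := by
  have h0 : (0 : C00) ∈ W₀ Ω₁ σ := G₀_subset_W₀ _ _ zero_mem_G₀
  refine le_antisymm (normOf_le zero_mem_G₀ fun f hf =>
    abs_pairing_le_normOf_W₀ (G₀_subset_W₀ _ _ hf) y) ?_
  by_contra! hlt
  refine (max_lt hlt hc).not_ge (normOf_le h0 fun f hf => ?_)
  by_cases hG : f ∈ G₀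
  · exact (abs_pairing_le_normOf_G₀ hG y).trans (le_max_left _ _)
  · exact (h f hf hG).trans (le_max_right _ _)

/-- James' argument: some level of the iterated averages does not lose norm. -/
theorem exists_level {Ω₁ : Set ℕ} {σ : List C00 → ℕ} {ε : ℝ} (hε0 : 0 < ε) {x : ℕ → C00}
    (hx : IsBlockSeq x) (hε : ∀ p, ε < normOf G₀ (x p)) (hW : ∀ p, normOf (W₀ Ω₁ σ) (x p) ≤ 1)
    {k : ℕ} (hk : 0 < k) {T q : ℕ} (hq : 1 ≤ q) (hT : k ^ T ≤ n (2 * q))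
    (hlarge : 1 < 1 / (m (2 * q) : ℝ) * (2 ^ T * ε)) :
    ∃ t < T, (∀ i, normOf (W₀ Ω₁ σ) (iterAvg k x t i) ≤ 1) ∧
      ∃ i, 1 < normOf (W₀ Ω₁ σ) (iterAvg k x (t + 1) i) := by
  by_contra! hcon
  have hall : ∀ t ≤ T, ∀ i, normOf (W₀ Ω₁ σ) (iterAvg k x t i) ≤ 1 := by
    intro t
    induction t with
    | zero => exact fun _ i => hW i
    | succ t ih => exact fun ht => hcon t ht (ih (Nat.le_of_succ_le ht))
  have h1 := le_normOf_G₀_iterAvg hε0 hx hε hk hq hT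
  have h2 : normOf G₀ (iterAvg k x T 0) ≤ normOf (W₀ Ω₁ σ) (iterAvg k x T 0) :=
    normOf_le zero_mem_G₀ fun f hf => abs_pairing_le_normOf_W₀ (G₀_subset_W₀ _ _ hf) _
  have h3 := hall T le_rfl 0
  linarith

open Classical in
/-- The action of special functionals of small index on a long average. -/
theorem abs_special_average_le {Ω₁ : Set ℕ} {σ : List C00 → ℕ} {k : ℕ} (hk : 0 < k) {y : ℕ → C00}
    (hy : ∀ r r', r < r' → Before (y r) (y r')) (hW : ∀ r, ∀ f ∈ W₀ Ω₁ σ, |pairing f (y r)| ≤ 1)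
    {j : ℕ} {L : List C00} (hL : IsSpecial Ω₁ σ j L) (P : ℕ+ → Prop) {s : ℝ} (hs : |s| = 1)
    (hf : s • (1 / (m (2 * j + 1) : ℝ)) • L.sum.filter P ∈ W₀ Ω₁ σ) :
    |1 / (k : ℝ) * ∑ r ∈ Finset.range k,
      pairing (s • (1 / (m (2 * j + 1) : ℝ)) • L.sum.filter P) (y r)| ≤
      (n (2 * j + 1) : ℝ) / k + 1 / (m (2 * j + 1) : ℝ) := by
  have hm : (0 : ℝ) < m (2 * j + 1) := by exact_mod_cast m_pos _
  refine abs_average_le hk (by positivity) (fun r _ => hW r _ hf) ?_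
  rw [← hL.length_eq]
  refine Nat.cast_le.2 (card_le_length_of_one_lt_abs_pairing (x := y)
    (u := fun r => (y r).filter P) (fun p _ p' _ h => hy p p' h)
    (fun p _ => support_filter_subset _ _) hL.mem.1.2.2 ?_ ?_)
  · intro r _ f hfL
    rw [← pairing_filter]
    exact hW r _ (G₀_subset_W₀ _ _ (filter_mem_G₀ P (hL.mem.2 f hfL)))
  · intro r hr
    have h := (Finset.mem_filter.1 hr).2
    rw [pairing_smul_left, pairing_smul_left, abs_mul, abs_mul, hs, one_mul,
      abs_of_pos (by positivity), pairing_filter] at h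
    have h' : 0 < 1 / (m (2 * j + 1) : ℝ) := by positivity
    exact (lt_mul_iff_one_lt_right h').1 h

open Classical in
/-- The action on iterated averages of a functional that is small on all but two members of the
sequence. -/
theorem abs_average_iterAvg_le {k : ℕ} (hk : 0 < k) {x : ℕ → C00}
    {t i : ℕ} {f : C00} {δ : ℝ} (hδ : 0 ≤ δ)
    (hW : ∀ l, |pairing f (iterAvg k x t l)| ≤ 1)
    (hF : ∀ F : Finset ℕ, (∀ p ∈ F, δ < |pairing f (x p)|) → F.card ≤ 2) :
    |1 / (k : ℝ) * ∑ r ∈ Finset.range k, pairing f (iterAvg k x t (k * i + r))| ≤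
      2 / k + 2 ^ t * δ := by
  refine abs_average_le hk (by positivity) (fun r _ => hW _) ?_
  set S := (Finset.range k).filter fun r => 2 ^ t * δ < |pairing f (iterAvg k x t (k * i + r))|
  have hp : ∀ r ∈ S, ∃ p, p / k ^ t = k * i + r ∧ δ < |pairing f (x p)| := by
    intro r hr
    by_contra! h
    exact (Finset.mem_filter.1 hr).2.not_ge (abs_pairing_iterAvg_le hk h)
  choose! p hp1 hp2 using hp
  have hinj : Set.InjOn p S := by
    intro r hr r' hr' h
    have h1 := hp1 r hr
    have h2 := hp1 r' hr'
    rw [h] at h1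
    omega
  have := hF (S.image p) (by
    intro l hl
    obtain ⟨r, hr, rfl⟩ := Finset.mem_image.1 hl
    exact hp2 r hr)
  rw [Finset.card_image_of_injOn hinj] at this
  exact_mod_cast this

/-- A choice of the length of the averages and of the number of iterations. -/
theorem exists_parameters {ε : ℝ} (hε : 0 < ε) (N : ℕ) :
    ∃ q k T : ℕ, 1 ≤ q ∧ N < k ∧ n (2 * q - 1) ^ 2 = k ∧ k ^ T ≤ n (2 * q) ∧
      2 ^ T = m (2 * q) ^ 2 ∧ 1 < m (2 * q) * ε := by
  obtain ⟨R, hR⟩ := exists_nat_gt (1 / ε)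
  set a := N + R with ha
  -- Here `8 * 5 ^ (2 * a + 1)` is `log₂ m_{2q}`, so `T = 2 log₂ m_{2q}`. Then `k ^ T` is `n_{2q-1}`
  -- to the power `4 log₂ m_{2q}`, the exponent in the recursion for `n_{2q}`.
  refine ⟨a + 1, n (2 * a + 1) ^ 2, 2 * (8 * 5 ^ (2 * a + 1)), by omega, ?_, rfl, ?_, ?_, ?_⟩
  · have := n_strictMono.le_apply (x := 2 * a + 1)
    calc N < n (2 * a + 1) := by omega
      _ ≤ n (2 * a + 1) ^ 2 := Nat.le_self_pow (by norm_num) _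
  · rw [show 2 * (a + 1) = 2 * a + 2 by ring, n, log_two_m_pow_four, ← pow_mul]
    calc n (2 * a + 1) ^ (2 * (2 * (8 * 5 ^ (2 * a + 1))))
        ≤ (2 * n (2 * a + 1)) ^ (2 * (2 * (8 * 5 ^ (2 * a + 1)))) :=
          Nat.pow_le_pow_left (by omega) _
      _ = _ := by congr 1; ring
  · rw [show 2 * (a + 1) = 2 * a + 1 + 1 by ring, m_succ_eq, ← pow_mul]; congr 1; ring
  · have h1 := m_strictMono.le_apply (x := 2 * (a + 1))
    have h2 : (R : ℝ) ≤ m (2 * (a + 1)) := by exact_mod_cast (show R ≤ m (2 * (a + 1)) by omega)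
    rw [← div_lt_iff₀ hε]
    exact hR.trans_le h2

theorem pow_five_le_m {q j : ℕ} (hq : 1 ≤ q) (hj : q ≤ j) : m (2 * q) ^ 5 ≤ m (2 * j + 1) := by
  obtain ⟨a, rfl⟩ : ∃ a, q = a + 1 := ⟨q - 1, by omega⟩
  refine le_trans (le_of_eq ?_) (m_strictMono.monotone (show 2 * (a + 1) + 1 ≤ 2 * j + 1 by omega))
  rw [show 2 * (a + 1) + 1 = (2 * a + 1) + 2 by ring, m]
  rfl

end X0

theorem mainTheorem5 (Ω₁ Ω₂ : Set ℕ) (σ : List X0.C00 → ℕ) (hσ : X0.IsCoding Ω₁ Ω₂ σ)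
    (ε : ℝ) (hε : 0 < ε) (x : ℕ → X0.C00) (hx : X0.IsBlockSeq x)
    (hnorm : ∀ i, ε < X0.normOf X0.G₀ (x i) ∧
      X0.normOf X0.G₀ (x i) ≤ X0.normOf (X0.W₀ Ω₁ σ) (x i) ∧
      X0.normOf (X0.W₀ Ω₁ σ) (x i) ≤ 1) :
    ∀ N : ℕ, ∃ k : ℕ, N < k ∧ ∃ y : Fin k → X0.C00,
      (∀ i, y i ∈ Submodule.span ℝ (Set.range x)) ∧
      (∀ i, y i ≠ 0) ∧
      (∀ i j, i < j → X0.Before (y i) (y j)) ∧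
      (∀ i, X0.normOf (X0.W₀ Ω₁ σ) (y i) ≤ 1) ∧
      1 / 2 < X0.normOf X0.G₀ ((1 / (k : ℝ)) • ∑ i, y i) ∧
      X0.normOf X0.G₀ ((1 / (k : ℝ)) • ∑ i, y i) =
        X0.normOf (X0.W₀ Ω₁ σ) ((1 / (k : ℝ)) • ∑ i, y i) := by
  classical
  open X0 in
  intro N
  obtain ⟨q, k, T, hq, hNk, hk, hkT, h2T, hεM⟩ := exists_parameters hε N
  obtain ⟨M, hM⟩ : ∃ M, M = m (2 * q) := ⟨_, rfl⟩
  obtain ⟨n₁, hn₁⟩ : ∃ n₁, n₁ = n (2 * q - 1) := ⟨_, rfl⟩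
  have hk0 : 0 < k := by omega
  have hM1 : 256 ≤ M := hM ▸ (show 256 ≤ m 1 by simp [m]).trans
    (m_strictMono.monotone (by omega : 1 ≤ 2 * q))
  have hn1 : 128 ≤ n₁ := hn₁ ▸ (show 128 ≤ n 1 by simp [n]).trans
    (n_strictMono.monotone (by omega : 1 ≤ 2 * q - 1))
  rw [← hM] at h2T hεM
  rw [← hn₁] at hk
  have hMR : (256 : ℝ) ≤ M := by exact_mod_cast hM1
  have hnR : (128 : ℝ) ≤ n₁ := by exact_mod_cast hn1
  have hkR : (k : ℝ) = n₁ ^ 2 := by exact_mod_cast hk.symm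
  have hkpos : (0 : ℝ) < k := by exact_mod_cast hk0
  have h2TR : (2 : ℝ) ^ T = M ^ 2 := by exact_mod_cast h2T
  -- Small enough that `2 ^ T * δ = 1 / 4`, yet `δ * m (2 * j + 1) ≥ M ^ 3 / 4 ≥ 2` for `j ≥ q`,
  -- because `m_{2q+1} = M ^ 5`.
  set δ : ℝ := 1 / (4 * M ^ 2) with hδ
  have hδ0 : 0 < δ := by positivity
  have hδm : ∀ j, q ≤ j → 2 ≤ δ * m (2 * j + 1) := by
    intro j hj
    have h5 : (M : ℝ) ^ 5 ≤ m (2 * j + 1) := by exact_mod_cast hM ▸ pow_five_le_m hq hj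
    calc (2 : ℝ) ≤ M ^ 3 / 4 := by nlinarith [pow_le_pow_left₀ (by norm_num) hMR 3]
      _ = δ * M ^ 5 := by rw [hδ]; field_simp
      _ ≤ _ := mul_le_mul_of_nonneg_left h5 hδ0.le
  obtain ⟨φ, hφ, hφ2⟩ := exists_subseq_card_le_two hσ hx (fun p g hg =>
    (abs_pairing_le_normOf_G₀ hg _).trans ((hnorm p).2.1.trans (hnorm p).2.2)) hδ0 hδm
  have hx' : IsBlockSeq (x ∘ φ) := fun i => hx.before (hφ (Nat.lt_succ_self i))
  have hε' : ∀ p, ε < normOf G₀ ((x ∘ φ) p) := fun p => (hnorm _).1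
  obtain ⟨t, htT, ht1, i, hti⟩ := exists_level hε hx' hε' (fun p => (hnorm (φ p)).2.2) hk0 hq hkT
    (by
      rw [h2TR, ← hM]
      have : (1 : ℝ) / M * (M ^ 2 * ε) = M * ε := by field_simp
      rw [this]; exact hεM)
  set z : ℕ → C00 := fun r => iterAvg k (x ∘ φ) t (k * i + r) with hz
  have hzB : ∀ r r', r < r' → Before (z r) (z r') := fun r r' h =>
    iterAvg_before hε hx' hε' hk0 t (by omega)
  have hzW : ∀ l, ∀ f ∈ W₀ Ω₁ σ, |pairing f (iterAvg k (x ∘ φ) t l)| ≤ 1 := fun l f hf =>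
    (abs_pairing_le_normOf_W₀ hf _).trans (ht1 l)
  refine ⟨k, hNk, fun r => z r, fun r => ?_, fun r => ?_, fun r r' h => hzB r r' h,
    fun r => ht1 _, ?_⟩
  · exact Submodule.span_mono (Set.range_comp_subset_range φ x) (iterAvg_mem_span t _)
  · exact iterAvg_ne_zero hε hx' hε' hk0 t _
  rw [Fin.sum_univ_eq_sum_range z k]
  set Y : C00 := (1 / (k : ℝ)) • ∑ r ∈ Finset.range k, z r with hY
  have hpY : ∀ f, pairing f Y = 1 / (k : ℝ) * ∑ r ∈ Finset.range k, pairing f (z r) := fun f => by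
    rw [hY, pairing_smul_right, pairing_sum_right]
  have h0W : (0 : C00) ∈ W₀ Ω₁ σ := G₀_subset_W₀ _ _ zero_mem_G₀
  have hYW : 1 / 2 < normOf (W₀ Ω₁ σ) Y := by
    by_contra! h
    refine hti.not_ge (normOf_le h0W fun f hf => ?_)
    have h2 : iterAvg k (x ∘ φ) (t + 1) i = (2 : ℝ) • Y := by
      rw [iterAvg, hY, smul_smul]; congr 1; ring
    rw [h2, pairing_smul_right, abs_mul, abs_two]
    linarith [(abs_pairing_le_normOf_W₀ hf Y).trans h]
  have heq : normOf G₀ Y = normOf (W₀ Ω₁ σ) Y := by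
    refine normOf_G₀_eq_normOf_W₀ hYW fun f hf hfG => ?_
    obtain hG | ⟨j, hj, L, hL, P, s, hs, rfl⟩ := mem_W₀_cases hf
    · exact absurd hG hfG
    rw [hpY]
    -- Both cases give `1/4 + 1/4`: many terms but `k = n₁ ^ 2` blocks when `j < q`, at most two
    -- large blocks when `j ≥ q`.
    rcases lt_or_ge j q with hjq | hjq
    · refine (abs_special_average_le hk0 hzB (fun r => hzW _) hL P hs hf).trans ?_
      have hnj : (n (2 * j + 1) : ℝ) ≤ n₁ := by
        exact_mod_cast hn₁ ▸ n_strictMono.monotone (show 2 * j + 1 ≤ 2 * q - 1 by omega)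
      have hmj : (256 : ℝ) ≤ m (2 * j + 1) := by
        exact_mod_cast (show 256 ≤ m 1 by simp [m]).trans
          (m_strictMono.monotone (show 1 ≤ 2 * j + 1 by omega))
      have h1 : (n (2 * j + 1) : ℝ) / k ≤ 1 / 4 := by
        rw [div_le_iff₀ hkpos, hkR]; nlinarith
      have h2 : 1 / (m (2 * j + 1) : ℝ) ≤ 1 / 4 := one_div_le_one_div_of_le (by norm_num) (by linarith)
      linarith
    · have hmpos : (0 : ℝ) < m (2 * j + 1) := by exact_mod_cast m_pos _
      refine (abs_average_iterAvg_le hk0 (i := i) hδ0.le (fun l => hzW l _ hf) fun F hF =>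
        hφ2 j hjq L hL P F fun p hp => ?_).trans ?_
      · have h := hF p hp
        rw [pairing_smul_left, pairing_smul_left, abs_mul, abs_mul, hs, one_mul,
          abs_of_pos (by positivity), pairing_filter, one_div, ← div_eq_inv_mul,
          lt_div_iff₀ hmpos] at h
        exact h
      · have h1 : (2 : ℝ) / k ≤ 1 / 4 := by
          rw [div_le_iff₀ hkpos, hkR]; nlinarith
        have h2 : (2 : ℝ) ^ t * δ ≤ 1 / 4 := by
          calc (2 : ℝ) ^ t * δ ≤ 2 ^ T * δ :=
                mul_le_mul_of_nonneg_right (pow_le_pow_right₀ (by norm_num) htT.le) hδ0.le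
            _ = 1 / 4 := by rw [h2TR, hδ]; field_simp
        linarith
  exact ⟨heq ▸ hYW, heq⟩
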